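/- Throughout, $|\cdot|$ is the Euclidean norm on $\mathbb R^n$, $e_1,\dots,e_n$ is the standard basis, $B_1^n$ and $B_\infty^n$ are the unit balls of $\ell_1^n$ and $\ell_\infty^n$, and $d_{\mathcal H}$ is the Hausdorff distance. A symmetric convex body is a compact convex set $K=-K$ with nonempty interior, and $d_{\mathcal{BM}}(K,L)=\inf\{c\ge 1: L\subset TK\subset cL \text{ for some } T\in GL(n)\}$. The dimension $\dim A$ of a nonempty set $A$ is the dimension of $\operatorname{span}(A-A)$. A face of a polytope $P$ is a nonempty set $F\neq P$ that is the intersection of $P$ with a supporting hyperplane, and $c_F$ denotes the centroid of $F$. A standard Hanner polytope in $\mathbb R^n$ is a set obtained from the intervals $[-e_1,e_1],\dots,[-e_n,e_n]$, each used exactly once, by repeatedly taking $\ell_1$-sums $H_1\oplus_1H_2=\operatorname{conv}(H_1\cup H_2)$ and $\ell_\infty$-sums $H_1\oplus_\infty H_2=H_1+H_2$. For such an $H$ with a fixed representation of this kind, an affine subspace $A_F$ is attached to every face $F$ of $H$ recursively as follows. * If $H$ is an interval, then $A_F=F$. * If $H=H_1\oplus_1H_2$, every face of $H$ is uniquely $F=\operatorname{conv}(F_1\cup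 F_2)$ with each $F_j$ a face of $H_j$ or empty, not both empty. Put $A_F=A_{F_1}+\operatorname{span}(H_2)$ if $F_2=\varnothing$, $A_F=\operatorname{span}(H_1)+A_{F_2}$ if $F_1=\varnothing$, and otherwise $$A_F=\frac{\dim F_1+1}{\dim F_1+\dim F_2+2}A_{F_1}+\frac{\dim F_2+1}{\dim F_1+\dim F_2+2}A_{F_2}.$$ * If $H=H_1\oplus_\infty H_2$, every face of $H$ is uniquely $F=F_1+F_2$ with each $F_j$ a face of $H_j$ or $F_j=H_j$, not both $F_j=H_j$. Put $A_F=A_{F_1}$ if $F_2=H_2$, $A_F=A_{F_2}$ if $F_1=H_1$, and otherwise $$A_F=A_{F_1}+A_{F_2}+\operatorname{span}\Big\{\frac{c_{F_1}}{\dim H_1-\dim F_1}-\frac{c_{F_2}}{\dim H_2-\dim F_2}\Big\}.$$ For a symmetric convex body $K_0$ and a face $F$ of $H$, let $t>0$ be such that $tA_F$ is tangent to $K_0$ (it meets $K_0$ but not the interior of $K_0$), and let $x_F$ be the point of $tA_F\cap\partial K_0$ nearest to $c_F$. **Proposition.** For every $n$ there are constants $C>0$ and $\delta_0>0$, depending only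 on $n$, with the following property. Let $H$ be a standard Hanner polytope in $\mathbb R^n$ (with a fixed representation), and let $K_0$ be a symmetric convex body in $\mathbb R^n$ with $d_{\mathcal H}(K_0,H)=\delta<\delta_0$. Let $P_0$ be the convex hull of the points $x_F$ of $K_0$, where $F$ runs over all faces of $H$. Then there is a symmetric polytope $K$ with nonempty interior such that $$|d_{\mathcal{BM}}(K,P_0)-1|\le C\delta^2,\qquad d_{\mathcal H}(K,H)\le C\delta,\qquad B_1^n\subset K\subset B_\infty^n .$$ -/

import Mathlib

open scoped Pointwise MeasureTheory

noncomputable section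

/-- The Euclidean space `ℝⁿ`. -/
abbrev EucSp (n : ℕ) : Type := EuclideanSpace ℝ (Fin n)

/-- A symmetric convex body in `ℝⁿ`: compact, convex, with nonempty interior, and `-K = K`. -/
structure IsSymmConvexBody {n : ℕ} (K : Set (EucSp n)) : Prop where
  convex : Convex ℝ K
  isCompact : IsCompact K
  nonempty_interior : (interior K).Nonempty
  symm : -K = K

/-- A (convex) polytope: the convex hull of a finite set. -/
def IsPolytope {n : ℕ} (K : Set (EucSp n)) : Prop :=
  ∃ s : Finset (EucSp n), K = convexHull ℝ (s : Set (EucSp n))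

/-- The unit ball `B₁ⁿ` of `ℓ₁` (the cross-polytope). -/
def crossBall (n : ℕ) : Set (EucSp n) := {x | ∑ i, |x i| ≤ 1}

/-- The unit ball `B_∞ⁿ` of `ℓ_∞` (the cube). -/
def cubeBall (n : ℕ) : Set (EucSp n) := {x | ∀ i, |x i| ≤ 1}

/-- The Banach-Mazur distance `inf {c ≥ 1 : L ⊆ T K ⊆ c L, T ∈ GL(n)}`. -/
def bmDist {n : ℕ} (K L : Set (EucSp n)) : ℝ :=
  sInf {c : ℝ | 1 ≤ c ∧ ∃ T : EucSp n ≃ₗ[ℝ] EucSp n, L ⊆ T '' K ∧ T '' K ⊆ c • L}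

/-- A (proper, nonempty) face of `P`: the intersection of `P` with a supporting hyperplane. -/
def IsFaceOf {n : ℕ} (P F : Set (EucSp n)) : Prop :=
  IsExposed ℝ P F ∧ F.Nonempty ∧ F ≠ P

/-- The dimension of a nonempty set: the dimension of the span of `A - A`. -/
def setDim {n : ℕ} (A : Set (EucSp n)) : ℕ := Module.finrank ℝ (vectorSpan ℝ A)

/-- The centroid of a convex set `A`, i.e. the average of the points of `A` with respect to the
`k`-dimensional (Hausdorff) measure, where `k = dim A`. -/
def setCentroid {n : ℕ} (A : Set (EucSp n)) : EucSp n :=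
  ⨍ x in A, x ∂(MeasureTheory.Measure.hausdorffMeasure (setDim A : ℝ))

/-- A representation of a Hanner polytope in `ℝⁿ` in terms of the intervals `[-eᵢ, eᵢ]` and
`ℓ₁`- and `ℓ_∞`-sums. -/
inductive HannerTree (n : ℕ) : Type
  | interval (i : Fin n) : HannerTree n
  | sumOne (H₁ H₂ : HannerTree n) : HannerTree n
  | sumInf (H₁ H₂ : HannerTree n) : HannerTree n

namespace HannerTree

variable {n : ℕ}

/-- The indices of the intervals that occur in the representation. -/
def leaves : HannerTree n → List (Fin n)
  | interval i => [i]
  | sumOne H₁ H₂ => H₁.leaves ++ H₂.leaves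
  | sumInf H₁ H₂ => H₁.leaves ++ H₂.leaves

/-- The representation uses each of the intervals `[-e₁, e₁], …, [-eₙ, eₙ]` exactly once, i.e. it
represents a standard Hanner polytope in `ℝⁿ`. -/
def IsStandard (H : HannerTree n) : Prop := H.leaves.Nodup ∧ ∀ i, i ∈ H.leaves

/-- The represented set: intervals `[-eᵢ, eᵢ]`, `ℓ₁`-sums `conv (H₁ ∪ H₂)` and `ℓ_∞`-sums
`H₁ + H₂`. -/
def body : HannerTree n → Set (EucSp n)
  | interval i =>
      segment ℝ (-EuclideanSpace.single i (1 : ℝ)) (EuclideanSpace.single i (1 : ℝ))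
  | sumOne H₁ H₂ => convexHull ℝ (H₁.body ∪ H₂.body)
  | sumInf H₁ H₂ => H₁.body + H₂.body

open Classical in
/-- The affine subspace `A_F` of a face `F` of a Hanner polytope with a given representation.

A face of the `ℓ₁`-sum of `H₁` and `H₂` is uniquely `conv (F₁ ∪ F₂)`, where each `Fⱼ` is a face of
`Hⱼ` or empty (not both empty), and then `Fⱼ = F ∩ Hⱼ`. A face of the `ℓ_∞`-sum is uniquely
`F₁ + F₂`, where each `Fⱼ` is a face of `Hⱼ` or all of `Hⱼ` (not both), and then `Fⱼ` is the
projection of `F` to `Hⱼ`. -/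
def faceAff : HannerTree n → Set (EucSp n) → Set (EucSp n)
  | interval _, F => F
  | sumOne H₁ H₂, F =>
      let F₁ : Set (EucSp n) := F ∩ H₁.body
      let F₂ : Set (EucSp n) := F ∩ H₂.body
      if F₂ = ∅ then
        H₁.faceAff F₁ + (Submodule.span ℝ H₂.body : Set (EucSp n))
      else if F₁ = ∅ then
        (Submodule.span ℝ H₁.body : Set (EucSp n)) + H₂.faceAff F₂
      else
        (((setDim F₁ : ℝ) + 1) / ((setDim F₁ : ℝ) + (setDim F₂ : ℝ) + 2)) • H₁.faceAff F₁ +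
        (((setDim F₂ : ℝ) + 1) / ((setDim F₁ : ℝ) + (setDim F₂ : ℝ) + 2)) • H₂.faceAff F₂
  | sumInf H₁ H₂, F =>
      let F₁ : Set (EucSp n) := {x | x ∈ H₁.body ∧ ∃ y ∈ H₂.body, x + y ∈ F}
      let F₂ : Set (EucSp n) := {y | y ∈ H₂.body ∧ ∃ x ∈ H₁.body, x + y ∈ F}
      if F₂ = H₂.body then
        H₁.faceAff F₁
      else if F₁ = H₁.body then
        H₂.faceAff F₂
      else
        H₁.faceAff F₁ + H₂.faceAff F₂ +
        (Submodule.span ℝ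
          {((setDim H₁.body : ℝ) - (setDim F₁ : ℝ))⁻¹ • setCentroid F₁ -
            ((setDim H₂.body : ℝ) - (setDim F₂ : ℝ))⁻¹ • setCentroid F₂} : Set (EucSp n))

end HannerTree

/-- The set `A` is tangent to the convex body `K`: it meets `K` but not the interior of `K`. -/
def IsTangentTo {n : ℕ} (A K : Set (EucSp n)) : Prop :=
  (A ∩ K).Nonempty ∧ Disjoint A (interior K)

/-- `x` is the point `x_F` constructed from `K`, `A = A_F` and `c = c_F`: for some `t > 0` the
dilate `t A` is tangent to `K`, and `x` is the point of `t A ∩ ∂K` nearest to `c`. -/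
def IsXPoint {n : ℕ} (K A : Set (EucSp n)) (c x : EucSp n) : Prop :=
  ∃ t : ℝ, 0 < t ∧ IsTangentTo (t • A) K ∧ x ∈ (t • A) ∩ frontier K ∧
    ∀ y ∈ (t • A) ∩ frontier K, dist x c ≤ dist y c

/-- The convex hull of the `x_F`-points of `K`, where `F` runs over the faces of `H`. -/
def xPointHull {n : ℕ} (H : HannerTree n) (K : Set (EucSp n)) : Set (EucSp n) :=
  convexHull ℝ {x | ∃ F, IsFaceOf H.body F ∧ IsXPoint K (H.faceAff F) (setCentroid F) x}

end

/-! The body `K` is a small perturbation of `S P₀`, where `P₀` is the convex hull of the points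
`x_F` and `S = 1 - E` is a linear map with `E = O(δ)`. `S` has to bring `P₀` into the cube and `±eᵢ`
into `S P₀`, both with an error of order `δ²` only.

Both bodies contain a fixed ball about the origin, so closeness in Hausdorff distance becomes `K₀ ⊆
(1 + ε)H` and `H ⊆ (1 + ε)K₀` with `ε` a multiple of `δ`. Call `i` and `j` linked if an `ℓ₁`-sum
separates them. If they are linked, then `|xᵢ| + |xⱼ| ≤ 1` on `H`. For `u ∈ H` with zero coordinates
at `i` and at every index linked to `i`, also `eᵢ + u ∈ H`. The face `xᵢ = 1` has the affine
subspace `eᵢ + span{eⱼ : j linked to i}` (`faceAff_coordFace`). Its point `Xᵢ = x_F` therefore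
vanishes at the unlinked `j ≠ i`, while separating a tangent dilate of that subspace from `K₀` gives
a functional `fᵢ ≤ 1` on `K₀` that vanishes at the linked `eⱼ`. The remaining off-diagonal entries
of `Xᵢ` and `fᵢ` are `O(ε)` (`exists_xPoint_coord`).

Thus `Xᵢ` and `fᵢ` carry complementary data, and `correction` merges them into one matrix `E`. Row
`i` of `S` agrees with `fᵢ` up to second order wherever the linked coordinates are `O(ε)`; elsewhere
`xᵢ` lies far enough below `1` to absorb the perturbation (`correction_apply_le`). In column `i`,
`eᵢ + E eᵢ` is `Xᵢ` plus a vector `w = O(ε)` in unlinked directions. Moving from `Xᵢ` by a fraction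
`O(ε)` towards a point of `P₀` approximates it to second order, and `S(1 + E) = 1 - E²`
(`exists_correction_near_single`).

That last step needs `P₀` to be `O(ε)`-close to `H`, which the points `x_F` of the vertices provide:
the subspace of a vertex `v` lies in a hyperplane that exposes `v` at a linear rate (`Exposes`,
`exists_near_xPointHull`). The other faces only contribute points of `K₀`.

Finally, `K` is the hull of `λ⁻¹ S P₀` and `±eᵢ` with `λ = 1 + O(ε²)`. It satisfies `λ⁻¹ S P₀ ⊆ K ⊆
λ S P₀`, so its distance to `P₀` is at most `λ²`. Constants are uniform because each dimension has
only finitely many standard representations. -/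

namespace HannerTree

variable {n : ℕ}

/-! ### Coordinates of Hanner polytopes and the linking relation. -/

/-- The vertices of the represented polytope. -/
def verts : HannerTree n → Set (EucSp n)
  | interval i => {-EuclideanSpace.single i (1 : ℝ), EuclideanSpace.single i (1 : ℝ)}
  | sumOne H₁ H₂ => H₁.verts ∪ H₂.verts
  | sumInf H₁ H₂ => H₁.verts + H₂.verts

/-- The intervals `i` and `j` are separated at an `ℓ₁`-sum. -/
def Linked : HannerTree n → Fin n → Fin n → Prop
  | interval _, _, _ => False
  | sumOne H₁ H₂, i, j => (i ∈ H₁.leaves ∧ j ∈ H₂.leaves) ∨ (i ∈ H₂.leaves ∧ j ∈ H₁.leaves) ∨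
      H₁.Linked i j ∨ H₂.Linked i j
  | sumInf H₁ H₂, i, j => H₁.Linked i j ∨ H₂.Linked i j

lemma Linked.symm {H : HannerTree n} {i j : Fin n} (h : H.Linked i j) : H.Linked j i := by
  induction H with
  | interval k => exact h
  | sumOne H₁ H₂ ih₁ ih₂ => simp only [Linked] at h ⊢; tauto
  | sumInf H₁ H₂ ih₁ ih₂ => simp only [Linked] at h ⊢; tauto

lemma Linked.left_mem {H : HannerTree n} {i j : Fin n} (h : H.Linked i j) : i ∈ H.leaves := by
  induction H with
  | interval k => exact h.elim
  | sumOne H₁ H₂ ih₁ ih₂ => simp only [Linked, leaves, List.mem_append] at h ⊢; tauto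
  | sumInf H₁ H₂ ih₁ ih₂ => simp only [Linked, leaves, List.mem_append] at h ⊢; tauto

lemma Linked.right_mem {H : HannerTree n} {i j : Fin n} (h : H.Linked i j) : j ∈ H.leaves :=
  h.symm.left_mem

lemma verts_finite (H : HannerTree n) : H.verts.Finite := by
  induction H with
  | interval i => exact (Set.finite_singleton _).insert _
  | sumOne H₁ H₂ ih₁ ih₂ => exact ih₁.union ih₂
  | sumInf H₁ H₂ ih₁ ih₂ => exact ih₁.add ih₂

lemma verts_nonempty (H : HannerTree n) : H.verts.Nonempty := by
  induction H with
  | interval i => exact Set.insert_nonempty _ _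
  | sumOne H₁ H₂ ih₁ ih₂ => exact ih₁.inl
  | sumInf H₁ H₂ ih₁ ih₂ => exact ih₁.add ih₂

lemma neg_verts (H : HannerTree n) : -H.verts = H.verts := by
  induction H with
  | interval i => simp [verts, Set.pair_comm]
  | sumOne H₁ H₂ ih₁ ih₂ => simp [verts, Set.union_neg, ih₁, ih₂]
  | sumInf H₁ H₂ ih₁ ih₂ => simp [verts, ih₁, ih₂, add_comm]

lemma convexHull_verts (H : HannerTree n) : convexHull ℝ H.verts = H.body := by
  induction H with
  | interval i => exact convexHull_pair _ _
  | sumOne H₁ H₂ ih₁ ih₂ =>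
    rw [body, ← ih₁, ← ih₂, convexHull_convexHull_union_left, convexHull_convexHull_union_right,
      verts]
  | sumInf H₁ H₂ ih₁ ih₂ => rw [body, ← ih₁, ← ih₂, verts, convexHull_add]

lemma convex_body (H : HannerTree n) : Convex ℝ H.body :=
  H.convexHull_verts ▸ convex_convexHull ℝ _

lemma isCompact_body (H : HannerTree n) : IsCompact H.body :=
  H.convexHull_verts ▸ H.verts_finite.isCompact_convexHull ℝ

lemma neg_body (H : HannerTree n) : -H.body = H.body := by
  rw [← H.convexHull_verts, ← convexHull_neg, neg_verts]

lemma neg_mem_body {H : HannerTree n} {x : EucSp n} (hx : x ∈ H.body) : -x ∈ H.body := by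
  rw [← H.neg_body]; simpa using hx

lemma verts_subset_body (H : HannerTree n) : H.verts ⊆ H.body :=
  H.convexHull_verts ▸ subset_convexHull ℝ _

lemma zero_mem_body (H : HannerTree n) : (0 : EucSp n) ∈ H.body := by
  obtain ⟨v, hv⟩ := H.verts_nonempty
  have h := H.verts_subset_body hv
  have := H.convex_body h (neg_mem_body h) (by norm_num : (0 : ℝ) ≤ 1 / 2)
    (by norm_num : (0 : ℝ) ≤ 1 / 2) (by norm_num)
  simpa using this

lemma smul_mem_body {H : HannerTree n} {x : EucSp n} (hx : x ∈ H.body) {t : ℝ} (h0 : 0 ≤ t)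
    (h1 : t ≤ 1) : t • x ∈ H.body :=
  H.convex_body.smul_mem_of_zero_mem H.zero_mem_body hx ⟨h0, h1⟩

lemma body_subset_sumOne_left (H₁ H₂ : HannerTree n) : H₁.body ⊆ (sumOne H₁ H₂).body :=
  Set.subset_union_left.trans (subset_convexHull ℝ _)

lemma body_subset_sumOne_right (H₁ H₂ : HannerTree n) : H₂.body ⊆ (sumOne H₁ H₂).body :=
  Set.subset_union_right.trans (subset_convexHull ℝ _)

lemma mem_sumOne_body {H₁ H₂ : HannerTree n} {x : EucSp n} :
    x ∈ (sumOne H₁ H₂).body ↔ ∃ x₁ ∈ H₁.body, ∃ x₂ ∈ H₂.body, ∃ a b : ℝ, 0 ≤ a ∧ 0 ≤ b ∧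
      a + b = 1 ∧ a • x₁ + b • x₂ = x := by
  rw [body, H₁.convex_body.convexHull_union H₂.convex_body ⟨0, H₁.zero_mem_body⟩
    ⟨0, H₂.zero_mem_body⟩, mem_convexJoin]
  simp only [segment, Set.mem_ofPred_eq]

lemma mem_sumInf_body {H₁ H₂ : HannerTree n} {x : EucSp n} :
    x ∈ (sumInf H₁ H₂).body ↔ ∃ x₁ ∈ H₁.body, ∃ x₂ ∈ H₂.body, x₁ + x₂ = x := Set.mem_add

lemma coord_eq_zero {H : HannerTree n} {i : Fin n} (hi : i ∉ H.leaves) {x : EucSp n}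
    (hx : x ∈ H.body) : x i = 0 := by
  induction H generalizing x with
  | interval k =>
    have hik : i ≠ k := by simpa [leaves] using hi
    obtain ⟨a, b, -, -, -, rfl⟩ := hx
    simp [hik]
  | sumOne H₁ H₂ ih₁ ih₂ =>
    simp only [leaves, List.mem_append, not_or] at hi
    obtain ⟨x₁, h₁, x₂, h₂, a, b, -, -, -, rfl⟩ := mem_sumOne_body.1 hx
    simp [ih₁ hi.1 h₁, ih₂ hi.2 h₂]
  | sumInf H₁ H₂ ih₁ ih₂ =>
    simp only [leaves, List.mem_append, not_or] at hi
    obtain ⟨x₁, h₁, x₂, h₂, rfl⟩ := mem_sumInf_body.1 hx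
    simp [ih₁ hi.1 h₁, ih₂ hi.2 h₂]

lemma single_mem_body {H : HannerTree n} {i : Fin n} (hi : i ∈ H.leaves) :
    EuclideanSpace.single i (1 : ℝ) ∈ H.body := by
  induction H with
  | interval k =>
    obtain rfl : i = k := by simpa [leaves] using hi
    exact right_mem_segment ℝ _ _
  | sumOne H₁ H₂ ih₁ ih₂ =>
    rcases List.mem_append.1 hi with h | h
    · exact body_subset_sumOne_left _ _ (ih₁ h)
    · exact body_subset_sumOne_right _ _ (ih₂ h)
  | sumInf H₁ H₂ ih₁ ih₂ =>
    rcases List.mem_append.1 hi with h | h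
    · exact mem_sumInf_body.2 ⟨_, ih₁ h, 0, H₂.zero_mem_body, add_zero _⟩
    · exact mem_sumInf_body.2 ⟨0, H₁.zero_mem_body, _, ih₂ h, zero_add _⟩

lemma nodup_left {H₁ H₂ : HannerTree n} (h : (H₁.leaves ++ H₂.leaves).Nodup) : H₁.leaves.Nodup :=
  (List.nodup_append.1 h).1

lemma nodup_right {H₁ H₂ : HannerTree n} (h : (H₁.leaves ++ H₂.leaves).Nodup) :
    H₂.leaves.Nodup :=
  (List.nodup_append.1 h).2.1

lemma not_mem_right {H₁ H₂ : HannerTree n} (h : (H₁.leaves ++ H₂.leaves).Nodup) {i : Fin n}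
    (hi : i ∈ H₁.leaves) : i ∉ H₂.leaves :=
  fun hj => (List.nodup_append.1 h).2.2 i hi i hj rfl

lemma not_mem_left {H₁ H₂ : HannerTree n} (h : (H₁.leaves ++ H₂.leaves).Nodup) {i : Fin n}
    (hi : i ∈ H₂.leaves) : i ∉ H₁.leaves :=
  fun hj => (List.nodup_append.1 h).2.2 i hj i hi rfl

lemma abs_coord_le_one {H : HannerTree n} (hH : H.leaves.Nodup) {x : EucSp n} (hx : x ∈ H.body)
    (i : Fin n) : |x i| ≤ 1 := by
  by_cases hi : i ∉ H.leaves
  · simp [coord_eq_zero hi hx]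
  push Not at hi
  induction H generalizing x with
  | interval k =>
    obtain rfl : i = k := by simpa [leaves] using hi
    obtain ⟨a, b, ha, hb, hab, rfl⟩ := hx
    simp only [smul_neg, PiLp.add_apply, PiLp.neg_apply, PiLp.smul_apply,
      PiLp.single_apply, if_true, smul_eq_mul, mul_one, abs_le]
    constructor <;> linarith
  | sumOne H₁ H₂ ih₁ ih₂ =>
    obtain ⟨x₁, h₁, x₂, h₂, a, b, ha, hb, hab, rfl⟩ := mem_sumOne_body.1 hx
    have e₁ : |x₁ i| ≤ 1 := by
      by_cases h : i ∈ H₁.leaves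
      · exact ih₁ (nodup_left hH) h₁ h
      · simp [coord_eq_zero h h₁]
    have e₂ : |x₂ i| ≤ 1 := by
      by_cases h : i ∈ H₂.leaves
      · exact ih₂ (nodup_right hH) h₂ h
      · simp [coord_eq_zero h h₂]
    simp only [PiLp.add_apply, PiLp.smul_apply, smul_eq_mul]
    calc |a * x₁ i + b * x₂ i| ≤ a * |x₁ i| + b * |x₂ i| := by
          refine (abs_add_le _ _).trans_eq ?_
          rw [abs_mul, abs_mul, abs_of_nonneg ha, abs_of_nonneg hb]
      _ ≤ a * 1 + b * 1 := by gcongr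
      _ = 1 := by linarith
  | sumInf H₁ H₂ ih₁ ih₂ =>
    obtain ⟨x₁, h₁, x₂, h₂, rfl⟩ := mem_sumInf_body.1 hx
    rcases List.mem_append.1 hi with h | h
    · simpa [coord_eq_zero (not_mem_right hH h) h₂] using ih₁ (nodup_left hH) h₁ h
    · simpa [coord_eq_zero (not_mem_left hH h) h₁] using ih₂ (nodup_right hH) h₂ h

/-- At the `ℓ₁`-sum that separates `i` and `j`, each of the two parts of `x` sees only one of the
two coordinates, and the parts are weighted by `a + b = 1`. -/
lemma abs_add_abs_le_one {H : HannerTree n} (hH : H.leaves.Nodup) {i j : Fin n}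
    (hij : H.Linked i j) {x : EucSp n} (hx : x ∈ H.body) : |x i| + |x j| ≤ 1 := by
  induction H generalizing x with
  | interval k => exact hij.elim
  | sumOne H₁ H₂ ih₁ ih₂ =>
    obtain ⟨x₁, h₁, x₂, h₂, a, b, ha, hb, hab, rfl⟩ := mem_sumOne_body.1 hx
    have a₁ := abs_coord_le_one (nodup_left hH) h₁
    have a₂ := abs_coord_le_one (nodup_right hH) h₂
    have key : |x₁ i| + |x₁ j| ≤ 1 ∧ |x₂ i| + |x₂ j| ≤ 1 := by
      rcases hij with ⟨hi, hj⟩ | ⟨hi, hj⟩ | h | h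
      · rw [coord_eq_zero (not_mem_left hH hj) h₁, coord_eq_zero (not_mem_right hH hi) h₂]
        simpa using ⟨a₁ i, a₂ j⟩
      · rw [coord_eq_zero (not_mem_left hH hi) h₁, coord_eq_zero (not_mem_right hH hj) h₂]
        simpa using ⟨a₁ j, a₂ i⟩
      · refine ⟨ih₁ (nodup_left hH) h h₁, ?_⟩
        rw [coord_eq_zero (not_mem_right hH h.left_mem) h₂,
          coord_eq_zero (not_mem_right hH h.right_mem) h₂]
        simp
      · refine ⟨?_, ih₂ (nodup_right hH) h h₂⟩
        rw [coord_eq_zero (not_mem_left hH h.left_mem) h₁,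
          coord_eq_zero (not_mem_left hH h.right_mem) h₁]
        simp
    simp only [PiLp.add_apply, PiLp.smul_apply, smul_eq_mul]
    have e : ∀ k, |a * x₁ k + b * x₂ k| ≤ a * |x₁ k| + b * |x₂ k| := fun k => by
      refine (abs_add_le _ _).trans_eq ?_
      rw [abs_mul, abs_mul, abs_of_nonneg ha, abs_of_nonneg hb]
    have := e i
    have := e j
    have := mul_le_mul_of_nonneg_left key.1 ha
    have := mul_le_mul_of_nonneg_left key.2 hb
    linarith
  | sumInf H₁ H₂ ih₁ ih₂ =>
    obtain ⟨x₁, h₁, x₂, h₂, rfl⟩ := mem_sumInf_body.1 hx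
    rcases hij with h | h
    · simpa [coord_eq_zero (not_mem_right hH h.left_mem) h₂,
        coord_eq_zero (not_mem_right hH h.right_mem) h₂] using ih₁ (nodup_left hH) h h₁
    · simpa [coord_eq_zero (not_mem_left hH h.left_mem) h₁,
        coord_eq_zero (not_mem_left hH h.right_mem) h₁] using ih₂ (nodup_right hH) h h₂

lemma eq_zero_of_coord {H : HannerTree n} {u : EucSp n} (hu : u ∈ H.body)
    (h : ∀ j ∈ H.leaves, u j = 0) : u = 0 := by
  ext j
  by_cases hj : j ∈ H.leaves
  · exact h j hj
  · exact coord_eq_zero hj hu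

/-- At an `ℓ₁`-sum every leaf of the summand without `i` is linked to `i`, so `u` lives in the
summand containing `i`. At an `ℓ_∞`-sum the part of `u` in the other summand is carried along
unchanged. -/
lemma single_add_mem_body {H : HannerTree n} (hH : H.leaves.Nodup) {i : Fin n}
    (hi : i ∈ H.leaves) {u : EucSp n} (hu : u ∈ H.body) (hui : u i = 0)
    (hl : ∀ j, H.Linked i j → u j = 0) : EuclideanSpace.single i (1 : ℝ) + u ∈ H.body := by
  induction H generalizing u with
  | interval k =>
    obtain rfl : i = k := by simpa [leaves] using hi
    obtain rfl : u = 0 := eq_zero_of_coord hu (by simpa [leaves] using hui)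
    simpa using single_mem_body (H := interval i) hi
  | sumOne H₁ H₂ ih₁ ih₂ =>
    obtain ⟨x₁, h₁, x₂, h₂, a, b, ha, hb, hab, rfl⟩ := mem_sumOne_body.1 hu
    simp only [PiLp.add_apply, PiLp.smul_apply, smul_eq_mul] at hui hl
    rcases List.mem_append.1 hi with h | h
    · have z : b • x₂ = 0 := by
        refine eq_zero_of_coord (smul_mem_body h₂ hb (by linarith)) fun j hj => ?_
        simpa [coord_eq_zero (not_mem_left hH hj) h₁] using hl j (Or.inl ⟨h, hj⟩)
      rw [z, add_zero]
      refine body_subset_sumOne_left _ _ (ih₁ (nodup_left hH) h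
        (smul_mem_body h₁ ha (by linarith)) ?_ fun j hj => ?_)
      · simpa [coord_eq_zero (not_mem_right hH h) h₂] using hui
      · simpa [coord_eq_zero (not_mem_right hH hj.right_mem) h₂] using
          hl j (Or.inr (Or.inr (Or.inl hj)))
    · have z : a • x₁ = 0 := by
        refine eq_zero_of_coord (smul_mem_body h₁ ha (by linarith)) fun j hj => ?_
        simpa [coord_eq_zero (not_mem_right hH hj) h₂] using hl j (Or.inr (Or.inl ⟨h, hj⟩))
      rw [z, zero_add]
      refine body_subset_sumOne_right _ _ (ih₂ (nodup_right hH) h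
        (smul_mem_body h₂ hb (by linarith)) ?_ fun j hj => ?_)
      · simpa [coord_eq_zero (not_mem_left hH h) h₁] using hui
      · simpa [coord_eq_zero (not_mem_left hH hj.right_mem) h₁] using
          hl j (Or.inr (Or.inr (Or.inr hj)))
  | sumInf H₁ H₂ ih₁ ih₂ =>
    obtain ⟨x₁, h₁, x₂, h₂, rfl⟩ := mem_sumInf_body.1 hu
    simp only [PiLp.add_apply] at hui hl
    rcases List.mem_append.1 hi with h | h
    · refine mem_sumInf_body.2 ⟨_, ih₁ (nodup_left hH) h h₁ ?_ fun j hj => ?_, x₂, h₂,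
        add_assoc _ _ _⟩
      · simpa [coord_eq_zero (not_mem_right hH h) h₂] using hui
      · simpa [coord_eq_zero (not_mem_right hH hj.right_mem) h₂] using hl j (Or.inl hj)
    · refine mem_sumInf_body.2 ⟨x₁, h₁, _, ih₂ (nodup_right hH) h h₂ ?_ fun j hj => ?_,
        add_left_comm _ _ _⟩
      · simpa [coord_eq_zero (not_mem_left hH h) h₁] using hui
      · simpa [coord_eq_zero (not_mem_left hH hj.right_mem) h₁] using hl j (Or.inr hj)

lemma span_body {H : HannerTree n} :
    Submodule.span ℝ H.body =
      Submodule.span ℝ {x | ∃ j ∈ H.leaves, EuclideanSpace.single j (1 : ℝ) = x} := by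
  apply le_antisymm
  · refine Submodule.span_le.2 fun x hx => ?_
    have hx' : x = ∑ j, x j • EuclideanSpace.single j (1 : ℝ) := by
      ext k
      simp [Pi.single_apply]
    rw [SetLike.mem_coe, hx']
    refine Submodule.sum_mem _ fun j _ => ?_
    by_cases hj : j ∈ H.leaves
    · exact Submodule.smul_mem _ _ (Submodule.subset_span ⟨j, hj, rfl⟩)
    · simp [coord_eq_zero hj hx]
  · refine Submodule.span_mono ?_
    rintro _ ⟨j, hj, rfl⟩
    exact single_mem_body hj

end HannerTree

/-! ### Coordinate faces and their affine subspaces. -/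

lemma setDim_singleton {n : ℕ} (v : EucSp n) : setDim {v} = 0 := by
  simp [setDim]

lemma setCentroid_singleton {n : ℕ} (v : EucSp n) : setCentroid {v} = v := by
  rw [setCentroid, setDim_singleton, MeasureTheory.setAverage_eq,
    MeasureTheory.Measure.restrict_singleton]
  simp [MeasureTheory.Measure.real]

lemma singleton_add_coe_add {E : Type*} [AddCommGroup E] [Module ℝ E] (a b : E)
    (V W : Submodule ℝ E) :
    ({a} + (V : Set E)) + ({b} + (W : Set E)) = {a + b} + ((V ⊔ W : Submodule ℝ E) : Set E) := by
  rw [add_add_add_comm, Set.singleton_add_singleton, Submodule.coe_sup]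

namespace HannerTree

variable {n : ℕ}

/-- The face of the represented polytope on which the coordinate `i` equals `1`. -/
def coordFace (H : HannerTree n) (i : Fin n) : Set (EucSp n) := {x | x ∈ H.body ∧ x i = 1}

/-- The span of the basis vectors linked to `i`. -/
def linkedSpan (H : HannerTree n) (i : Fin n) : Submodule ℝ (EucSp n) :=
  Submodule.span ℝ {x | ∃ j, H.Linked i j ∧ EuclideanSpace.single j (1 : ℝ) = x}

lemma single_mem_linkedSpan {H : HannerTree n} {i j : Fin n} (h : H.Linked i j) :
    EuclideanSpace.single j (1 : ℝ) ∈ H.linkedSpan i := Submodule.subset_span ⟨j, h, rfl⟩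

lemma coord_linkedSpan {H : HannerTree n} {i j : Fin n} (h : ¬ H.Linked i j) {x : EucSp n}
    (hx : x ∈ H.linkedSpan i) : x j = 0 := by
  induction hx using Submodule.span_induction with
  | mem x hx =>
    obtain ⟨k, hk, rfl⟩ := hx
    have : j ≠ k := by rintro rfl; exact h hk
    simp [this]
  | zero => simp
  | add x y _ _ hx hy => simp [hx, hy]
  | smul a x _ hx => simp [hx]

lemma not_linked_self {H : HannerTree n} (hH : H.leaves.Nodup) (i : Fin n) :
    ¬ H.Linked i i := by
  induction H with
  | interval k => exact id
  | sumOne H₁ H₂ ih₁ ih₂ =>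
    rintro (⟨h, h'⟩ | ⟨h, h'⟩ | h | h)
    · exact not_mem_right hH h h'
    · exact not_mem_left hH h h'
    · exact ih₁ (nodup_left hH) h
    · exact ih₂ (nodup_right hH) h
  | sumInf H₁ H₂ ih₁ ih₂ =>
    rintro (h | h)
    · exact ih₁ (nodup_left hH) h
    · exact ih₂ (nodup_right hH) h

lemma linkedSpan_eq_bot {H : HannerTree n} {i : Fin n} (h : ∀ j, ¬ H.Linked i j) :
    H.linkedSpan i = ⊥ := by
  rw [linkedSpan, Submodule.span_eq_bot]
  rintro _ ⟨j, hj, rfl⟩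
  exact (h j hj).elim

lemma coordFace_nonempty {H : HannerTree n} {i : Fin n} (hi : i ∈ H.leaves) :
    (H.coordFace i).Nonempty := ⟨_, single_mem_body hi, by simp⟩

lemma coordFace_ne_body {H : HannerTree n} {i : Fin n} : H.coordFace i ≠ H.body := by
  intro h
  have := h ▸ H.zero_mem_body
  simp [coordFace] at this

lemma coordFace_eq_empty {H : HannerTree n} {i : Fin n} (hi : i ∉ H.leaves) :
    H.coordFace i = ∅ :=
  Set.eq_empty_of_forall_notMem fun x hx => by
    have := coord_eq_zero hi hx.1
    rw [hx.2] at this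
    exact one_ne_zero this

lemma isFaceOf_coordFace {H : HannerTree n} (hH : H.leaves.Nodup) {i : Fin n}
    (hi : i ∈ H.leaves) : IsFaceOf H.body (H.coordFace i) := by
  refine ⟨fun _ => ⟨EuclideanSpace.proj i, ?_⟩, coordFace_nonempty hi, coordFace_ne_body⟩
  ext x
  simp only [coordFace, Set.mem_ofPred_eq]
  change _ ↔ _ ∧ ∀ y ∈ H.body, y i ≤ x i
  refine and_congr_right fun hx => ⟨fun h y hy => ?_, fun h => ?_⟩
  · rw [h]; exact (abs_le.1 (abs_coord_le_one hH hy i)).2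
  · refine le_antisymm (abs_le.1 (abs_coord_le_one hH hx i)).2 ?_
    simpa using h _ (single_mem_body hi)

lemma coordFace_sumOne_inter_left (H₁ H₂ : HannerTree n) (i : Fin n) :
    (sumOne H₁ H₂).coordFace i ∩ H₁.body = H₁.coordFace i := by
  ext x
  simp only [coordFace, Set.mem_inter_iff, Set.mem_ofPred_eq]
  exact ⟨fun h => ⟨h.2, h.1.2⟩, fun h => ⟨⟨body_subset_sumOne_left _ _ h.1, h.2⟩, h.1⟩⟩

lemma coordFace_sumOne_inter_right (H₁ H₂ : HannerTree n) (i : Fin n) :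
    (sumOne H₁ H₂).coordFace i ∩ H₂.body = H₂.coordFace i := by
  ext x
  simp only [coordFace, Set.mem_inter_iff, Set.mem_ofPred_eq]
  exact ⟨fun h => ⟨h.2, h.1.2⟩, fun h => ⟨⟨body_subset_sumOne_right _ _ h.1, h.2⟩, h.1⟩⟩

/-- An `ℓ₁`-sum leaves the other part of the face empty and adds the span of that summand, whose
leaves are exactly the newly linked indices. An `ℓ_∞`-sum has the whole other summand as its second
part and adds nothing. -/
lemma faceAff_coordFace {H : HannerTree n} (hH : H.leaves.Nodup) {i : Fin n}
    (hi : i ∈ H.leaves) :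
    H.faceAff (H.coordFace i) = {EuclideanSpace.single i (1 : ℝ)} + (H.linkedSpan i : Set _) := by
  induction H with
  | interval k =>
    obtain rfl : i = k := by simpa [leaves] using hi
    rw [linkedSpan_eq_bot (fun _ => id), faceAff]
    ext x
    simp only [Submodule.bot_coe, Set.singleton_add_singleton, add_zero, Set.mem_singleton_iff]
    constructor
    · rintro ⟨h1, h2⟩
      ext j
      by_cases hj : j = i
      · subst hj; simpa using h2
      · simpa [hj] using coord_eq_zero (H := interval i) (by simpa [leaves] using hj) h1
    · rintro rfl
      exact ⟨single_mem_body hi, by simp⟩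
  | sumOne H₁ H₂ ih₁ ih₂ =>
    rw [faceAff]
    simp only [coordFace_sumOne_inter_left, coordFace_sumOne_inter_right]
    rcases List.mem_append.1 hi with h | h
    · rw [if_pos (coordFace_eq_empty (not_mem_right hH h)), ih₁ (nodup_left hH) h, add_assoc,
        ← Submodule.coe_sup, span_body, linkedSpan, ← Submodule.span_union]
      congr 3
      ext x
      simp only [Linked, Set.mem_union, Set.mem_ofPred_eq, h, not_mem_right hH h, true_and,
        false_and, false_or]
      constructor
      · rintro (⟨j, hj, rfl⟩ | ⟨j, hj, rfl⟩)
        · exact ⟨j, Or.inr (Or.inl hj), rfl⟩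
        · exact ⟨j, Or.inl hj, rfl⟩
      · rintro ⟨j, hj | hj | hj, rfl⟩
        · exact Or.inr ⟨j, hj, rfl⟩
        · exact Or.inl ⟨j, hj, rfl⟩
        · exact (not_mem_right hH h hj.left_mem).elim
    · rw [if_neg (coordFace_nonempty h).ne_empty,
        if_pos (coordFace_eq_empty (not_mem_left hH h)), ih₂ (nodup_right hH) h, add_left_comm,
        ← Submodule.coe_sup, span_body, linkedSpan, ← Submodule.span_union]
      congr 3
      ext x
      simp only [Linked, Set.mem_union, Set.mem_ofPred_eq, h, not_mem_left hH h, true_and,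
        false_and, false_or]
      constructor
      · rintro (⟨j, hj, rfl⟩ | ⟨j, hj, rfl⟩)
        · exact ⟨j, Or.inl hj, rfl⟩
        · exact ⟨j, Or.inr (Or.inr hj), rfl⟩
      · rintro ⟨j, hj | hj | hj, rfl⟩
        · exact Or.inl ⟨j, hj, rfl⟩
        · exact (not_mem_left hH h hj.left_mem).elim
        · exact Or.inr ⟨j, hj, rfl⟩
  | sumInf H₁ H₂ ih₁ ih₂ =>
    rw [faceAff]
    rcases List.mem_append.1 hi with h | h
    · have e₁ : {x | x ∈ H₁.body ∧ ∃ y ∈ H₂.body, x + y ∈ (sumInf H₁ H₂).coordFace i} =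
          H₁.coordFace i := by
        ext x
        constructor
        · rintro ⟨hx, y, hy, -, hxy⟩
          exact ⟨hx, by simpa [coord_eq_zero (not_mem_right hH h) hy] using hxy⟩
        · rintro ⟨hx, hxi⟩
          exact ⟨hx, 0, H₂.zero_mem_body, mem_sumInf_body.2 ⟨x, hx, 0, H₂.zero_mem_body, rfl⟩,
            by simpa using hxi⟩
      have e₂ : {y | y ∈ H₂.body ∧ ∃ x ∈ H₁.body, x + y ∈ (sumInf H₁ H₂).coordFace i} =
          H₂.body := by
        ext y
        refine ⟨fun hy => hy.1, fun hy => ⟨hy, _, single_mem_body h,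
          mem_sumInf_body.2 ⟨_, single_mem_body h, y, hy, rfl⟩, ?_⟩⟩
        simp [coord_eq_zero (not_mem_right hH h) hy]
      simp only [e₁, e₂, if_true]
      rw [ih₁ (nodup_left hH) h]
      have : ∀ j, ¬ H₂.Linked i j := fun j hj => not_mem_right hH h hj.left_mem
      simp [linkedSpan, Linked, this]
    · have e₁ : {x | x ∈ H₁.body ∧ ∃ y ∈ H₂.body, x + y ∈ (sumInf H₁ H₂).coordFace i} =
          H₁.body := by
        ext x
        refine ⟨fun hx => hx.1, fun hx => ⟨hx, _, single_mem_body h,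
          mem_sumInf_body.2 ⟨x, hx, _, single_mem_body h, rfl⟩, ?_⟩⟩
        simp [coord_eq_zero (not_mem_left hH h) hx]
      have e₂ : {y | y ∈ H₂.body ∧ ∃ x ∈ H₁.body, x + y ∈ (sumInf H₁ H₂).coordFace i} =
          H₂.coordFace i := by
        ext y
        constructor
        · rintro ⟨hy, x, hx, -, hxy⟩
          exact ⟨hy, by simpa [coord_eq_zero (not_mem_left hH h) hx] using hxy⟩
        · rintro ⟨hy, hyi⟩
          exact ⟨hy, 0, H₁.zero_mem_body, mem_sumInf_body.2 ⟨0, H₁.zero_mem_body, y, hy, rfl⟩,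
            by simpa using hyi⟩
      simp only [e₁, e₂, if_true, if_neg coordFace_ne_body]
      rw [ih₂ (nodup_right hH) h]
      have : ∀ j, ¬ H₁.Linked i j := fun j hj => not_mem_left hH h hj.left_mem
      simp [linkedSpan, Linked, this]

/-! ### Vertices and the functionals that expose them. -/

lemma verts_ne_zero {H : HannerTree n} (hH : H.leaves.Nodup) {v : EucSp n} (hv : v ∈ H.verts) :
    v ≠ 0 := by
  induction H generalizing v with
  | interval i =>
    rcases hv with rfl | rfl <;> simp
  | sumOne H₁ H₂ ih₁ ih₂ =>
    rcases hv with h | h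
    · exact ih₁ (nodup_left hH) h
    · exact ih₂ (nodup_right hH) h
  | sumInf H₁ H₂ ih₁ ih₂ =>
    obtain ⟨v₁, h₁, v₂, h₂, rfl⟩ := hv
    intro h0
    refine ih₁ (nodup_left hH) h₁ (eq_zero_of_coord (verts_subset_body _ h₁) fun j hj => ?_)
    have := congrArg (fun x : EucSp n => x j) h0
    simpa [coord_eq_zero (not_mem_right hH hj) (verts_subset_body _ h₂)] using this

lemma body_ne_singleton {H : HannerTree n} (hH : H.leaves.Nodup) {v : EucSp n}
    (hv : v ∈ H.verts) : ({v} : Set (EucSp n)) ≠ H.body := fun h => by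
  have h0 : (0 : EucSp n) ∈ ({v} : Set _) := h ▸ H.zero_mem_body
  exact verts_ne_zero hH hv (Set.mem_singleton_iff.1 h0).symm

lemma setDim_body_pos {H : HannerTree n} (hH : H.leaves.Nodup) : 0 < setDim H.body := by
  obtain ⟨v, hv⟩ := H.verts_nonempty
  rw [setDim, Module.finrank_pos_iff]
  refine ⟨⟨v, ?_⟩, 0, fun h => verts_ne_zero hH hv (congrArg Subtype.val h)⟩
  simpa using vsub_mem_vectorSpan ℝ (H.verts_subset_body hv) H.zero_mem_body

lemma coord_span_body {H : HannerTree n} {x : EucSp n} (hx : x ∈ Submodule.span ℝ H.body)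
    {j : Fin n} (hj : j ∉ H.leaves) : x j = 0 := by
  induction hx using Submodule.span_induction with
  | mem x hx => exact coord_eq_zero hj hx
  | zero => simp
  | add x y _ _ hx hy => simp [hx, hy]
  | smul a x _ hx => simp [hx]

/-- The vertex `v` of `H` is exposed, with a linear rate `c`, by a functional `φ` supported on the
leaves of `H`, and the affine subspace attached to `{v}` lies in `φ = 1`. -/
structure Exposes (H : HannerTree n) (v : EucSp n) (V : Submodule ℝ (EucSp n))
    (φ : EucSp n →ₗ[ℝ] ℝ) (c : ℝ) : Prop where
  faceAff_eq : H.faceAff {v} = {v} + (V : Set (EucSp n))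
  map_eq_zero : ∀ x ∈ V, φ x = 0
  coord_eq_zero : ∀ x ∈ V, ∀ j ∉ H.leaves, x j = 0
  map_vertex : φ v = 1
  map_eq_zero_of_coord : ∀ x, (∀ j ∈ H.leaves, x j = 0) → φ x = 0
  rate_nonneg : 0 ≤ c
  norm_sub_le : ∀ x ∈ H.body, ‖x - v‖ ≤ c * (1 - φ x)

lemma Exposes.map_le_one {H : HannerTree n} {v : EucSp n} {V : Submodule ℝ (EucSp n)}
    {φ : EucSp n →ₗ[ℝ] ℝ} {c : ℝ} (h : H.Exposes v V φ c) {x : EucSp n} (hx : x ∈ H.body) :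
    0 ≤ 1 - φ x := by
  by_contra hneg
  push Not at hneg
  have hxv : x - v = 0 := norm_le_zero_iff.1 ((h.norm_sub_le x hx).trans
    (mul_nonpos_of_nonneg_of_nonpos h.rate_nonneg hneg.le))
  rw [sub_eq_zero.1 hxv, h.map_vertex] at hneg
  linarith

/-- With `φ y = 0` the deficit `1 - φ` at the convex combination is `a (1 - φ x) + b`. The first
term pays for the distance of `x` to `v`, the second for that of `y`. -/
lemma Exposes.norm_join_sub_le {H : HannerTree n} {v : EucSp n} {V : Submodule ℝ (EucSp n)}
    {φ : EucSp n →ₗ[ℝ] ℝ} {c : ℝ} (h : H.Exposes v V φ c) {x y : EucSp n} (hx : x ∈ H.body)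
    (hy : φ y = 0) {M : ℝ} (hM : ‖y‖ ≤ M) {a b : ℝ} (ha : 0 ≤ a) (hb : 0 ≤ b)
    (hab : a + b = 1) :
    ‖a • x + b • y - v‖ ≤ (c + (M + ‖v‖)) * (1 - φ (a • x + b • y)) := by
  have e : a • x + b • y - v = a • (x - v) + b • (y - v) := by
    obtain rfl : b = 1 - a := by linarith
    module
  have hM0 : 0 ≤ M := (norm_nonneg _).trans hM
  have hc := h.rate_nonneg
  have h1 := h.map_le_one hx
  have f : ‖y - v‖ ≤ M + ‖v‖ := (_root_.norm_sub_le _ _).trans (by linarith)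
  rw [e, map_add, map_smul, map_smul, hy, smul_zero, add_zero, smul_eq_mul]
  calc ‖a • (x - v) + b • (y - v)‖ ≤ a * ‖x - v‖ + b * ‖y - v‖ := by
        refine (norm_add_le _ _).trans_eq ?_
        rw [norm_smul, norm_smul, Real.norm_of_nonneg ha, Real.norm_of_nonneg hb]
    _ ≤ a * (c * (1 - φ x)) + b * (M + ‖v‖) := by
        have := h.norm_sub_le x hx
        gcongr
    _ ≤ (c + (M + ‖v‖)) * (a * (1 - φ x) + b) := by
        have h1 : 0 ≤ c * b := by positivity
        have h2 : 0 ≤ (M + ‖v‖) * (a * (1 - φ x)) := by positivity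
        linarith
    _ = _ := by linear_combination (c + (M + ‖v‖)) * hab

lemma exposes_interval {i : Fin n} {s : ℝ} (hs : s = 1 ∨ s = -1) :
    (interval i).Exposes (s • EuclideanSpace.single i (1 : ℝ)) ⊥
      (s • (EuclideanSpace.proj i : EucSp n →L[ℝ] ℝ).toLinearMap) 1 where
  faceAff_eq := by simp [faceAff]
  map_eq_zero := by simp
  coord_eq_zero := by simp
  map_vertex := by rcases hs with rfl | rfl <;> simp
  map_eq_zero_of_coord x hx := by
    have := hx i (by simp [leaves])
    simp [this]
  rate_nonneg := zero_le_one
  norm_sub_le x hx := by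
    have hxe : x = x i • EuclideanSpace.single i (1 : ℝ) := by
      ext j
      by_cases hj : j = i
      · subst hj; simp
      · simpa [hj] using coord_eq_zero (H := interval i) (by simpa [leaves] using hj) hx
    have hxi := abs_le.1 (abs_coord_le_one (H := interval i) (by simp [leaves]) hx i)
    have e : x - s • EuclideanSpace.single i (1 : ℝ) =
        (x i - s) • EuclideanSpace.single i (1 : ℝ) := by
      rw [sub_smul, ← hxe]
    rw [e, norm_smul]
    have hp : (EuclideanSpace.proj i : EucSp n →L[ℝ] ℝ) x = x i := rfl
    simp only [Real.norm_eq_abs, PiLp.norm_single, norm_one, mul_one, one_mul,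
      LinearMap.smul_apply, smul_eq_mul, ContinuousLinearMap.coe_coe, hp]
    rcases hs with rfl | rfl
    · rw [abs_of_nonpos (by linarith)]; linarith
    · rw [abs_of_nonneg (by linarith)]; linarith

lemma Exposes.sumOne_left {H₁ H₂ : HannerTree n} (hH : (H₁.leaves ++ H₂.leaves).Nodup)
    {v : EucSp n} {V : Submodule ℝ (EucSp n)} {φ : EucSp n →ₗ[ℝ] ℝ} {c : ℝ}
    (h : H₁.Exposes v V φ c) (hv : v ∈ H₁.body) :
    ∃ c', (sumOne H₁ H₂).Exposes v (V ⊔ Submodule.span ℝ H₂.body) φ c' := by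
  have z : ∀ x ∈ H₂.body, φ x = 0 := fun x hx =>
    h.map_eq_zero_of_coord x fun j hj => HannerTree.coord_eq_zero (not_mem_right hH hj) hx
  obtain ⟨M, hM⟩ := H₂.isCompact_body.isBounded.exists_norm_le
  have hM0 : 0 ≤ M := (norm_nonneg _).trans (hM 0 H₂.zero_mem_body)
  have hc := h.rate_nonneg
  refine ⟨c + (M + ‖v‖), ?_, ?_, ?_, h.map_vertex,
    fun x hx => h.map_eq_zero_of_coord x fun j hj => hx j (by simp [leaves, hj]),
    by positivity, ?_⟩
  · have e₁ : ({v} : Set (EucSp n)) ∩ H₁.body = {v} := by simpa using hv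
    have e₂ : ({v} : Set (EucSp n)) ∩ H₂.body = ∅ := by
      rw [Set.singleton_inter_eq_empty]
      intro hv2
      exact zero_ne_one ((z v hv2).symm.trans h.map_vertex)
    rw [faceAff]
    simp only [e₁, e₂, if_true]
    rw [h.faceAff_eq, Submodule.coe_sup, add_assoc]
  · have : V ⊔ Submodule.span ℝ H₂.body ≤ LinearMap.ker φ :=
      sup_le (fun x hx => h.map_eq_zero x hx) (Submodule.span_le.2 fun x hx => z x hx)
    exact fun x hx => this hx
  · intro x hx j hj
    simp only [leaves, List.mem_append, not_or] at hj
    obtain ⟨y, hy, w, hw, rfl⟩ := Submodule.mem_sup.1 hx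
    simp [h.coord_eq_zero y hy j hj.1, coord_span_body hw hj.2]
  · intro x hx
    obtain ⟨x₁, h₁, x₂, h₂, a, b, ha, hb, hab, rfl⟩ := mem_sumOne_body.1 hx
    exact h.norm_join_sub_le h₁ (z _ h₂) (hM _ h₂) ha hb hab

lemma Exposes.sumOne_right {H₁ H₂ : HannerTree n} (hH : (H₁.leaves ++ H₂.leaves).Nodup)
    {v : EucSp n} {V : Submodule ℝ (EucSp n)} {φ : EucSp n →ₗ[ℝ] ℝ} {c : ℝ}
    (h : H₂.Exposes v V φ c) (hv : v ∈ H₂.body) :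
    ∃ c', (sumOne H₁ H₂).Exposes v (Submodule.span ℝ H₁.body ⊔ V) φ c' := by
  have z : ∀ x ∈ H₁.body, φ x = 0 := fun x hx =>
    h.map_eq_zero_of_coord x fun j hj => HannerTree.coord_eq_zero (not_mem_left hH hj) hx
  obtain ⟨M, hM⟩ := H₁.isCompact_body.isBounded.exists_norm_le
  have hM0 : 0 ≤ M := (norm_nonneg _).trans (hM 0 H₁.zero_mem_body)
  have hc := h.rate_nonneg
  refine ⟨c + (M + ‖v‖), ?_, ?_, ?_, h.map_vertex,
    fun x hx => h.map_eq_zero_of_coord x fun j hj => hx j (by simp [leaves, hj]),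
    by positivity, ?_⟩
  · have e₁ : ({v} : Set (EucSp n)) ∩ H₂.body = {v} := by simpa using hv
    have e₂ : ({v} : Set (EucSp n)) ∩ H₁.body = ∅ := by
      rw [Set.singleton_inter_eq_empty]
      intro hv2
      exact zero_ne_one ((z v hv2).symm.trans h.map_vertex)
    rw [faceAff]
    simp only [e₁, e₂, if_true, if_neg (Set.singleton_ne_empty v)]
    rw [h.faceAff_eq, Submodule.coe_sup, add_left_comm]
  · have : Submodule.span ℝ H₁.body ⊔ V ≤ LinearMap.ker φ :=
      sup_le (Submodule.span_le.2 fun x hx => z x hx) (fun x hx => h.map_eq_zero x hx)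
    exact fun x hx => this hx
  · intro x hx j hj
    simp only [leaves, List.mem_append, not_or] at hj
    obtain ⟨y, hy, w, hw, rfl⟩ := Submodule.mem_sup.1 hx
    simp [coord_span_body hy hj.1, h.coord_eq_zero w hw j hj.2]
  · intro x hx
    obtain ⟨x₁, h₁, x₂, h₂, a, b, ha, hb, hab, rfl⟩ := mem_sumOne_body.1 hx
    rw [add_comm (a • x₁)]
    exact h.norm_join_sub_le h₂ (z _ h₁) (hM _ h₁) hb ha (by linarith)

/-- The new functional is the convex combination `α φ₁ + β φ₂`. The only further condition is that
it vanish on the extra direction `p₁ v₁ - p₂ v₂`, that is `α p₁ = β p₂`, which fixes the weights. -/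
lemma Exposes.sumInf {H₁ H₂ : HannerTree n} (hH : (H₁.leaves ++ H₂.leaves).Nodup)
    {v₁ v₂ : EucSp n} {V₁ V₂ : Submodule ℝ (EucSp n)} {φ₁ φ₂ : EucSp n →ₗ[ℝ] ℝ} {c₁ c₂ : ℝ}
    (h₁ : H₁.Exposes v₁ V₁ φ₁ c₁) (hv₁ : v₁ ∈ H₁.verts)
    (h₂ : H₂.Exposes v₂ V₂ φ₂ c₂) (hv₂ : v₂ ∈ H₂.verts) :
    ∃ V φ c, (sumInf H₁ H₂).Exposes (v₁ + v₂) V φ c := by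
  have hb₁ := H₁.verts_subset_body hv₁
  have hb₂ := H₂.verts_subset_body hv₂
  have z₁ : ∀ x : EucSp n, (∀ j ∉ H₂.leaves, x j = 0) → φ₁ x = 0 := fun x hx =>
    h₁.map_eq_zero_of_coord x fun j hj => hx j (not_mem_right hH hj)
  have z₂ : ∀ x : EucSp n, (∀ j ∉ H₁.leaves, x j = 0) → φ₂ x = 0 := fun x hx =>
    h₂.map_eq_zero_of_coord x fun j hj => hx j (not_mem_left hH hj)
  have y₁ : ∀ x ∈ H₂.body, φ₁ x = 0 := fun x hx =>
    z₁ x fun j hj => HannerTree.coord_eq_zero hj hx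
  have y₂ : ∀ x ∈ H₁.body, φ₂ x = 0 := fun x hx =>
    z₂ x fun j hj => HannerTree.coord_eq_zero hj hx
  obtain ⟨p₁, hp₁⟩ : ∃ p, p = (setDim H₁.body : ℝ)⁻¹ := ⟨_, rfl⟩
  obtain ⟨p₂, hp₂⟩ : ∃ p, p = (setDim H₂.body : ℝ)⁻¹ := ⟨_, rfl⟩
  have hp₁0 : 0 < p₁ := by
    rw [hp₁]; exact inv_pos.2 (Nat.cast_pos.2 (setDim_body_pos (nodup_left hH)))
  have hp₂0 : 0 < p₂ := by
    rw [hp₂]; exact inv_pos.2 (Nat.cast_pos.2 (setDim_body_pos (nodup_right hH)))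
  obtain ⟨α, hα⟩ : ∃ α, α = p₂ / (p₁ + p₂) := ⟨_, rfl⟩
  obtain ⟨β, hβ⟩ : ∃ β, β = p₁ / (p₁ + p₂) := ⟨_, rfl⟩
  have hα0 : 0 < α := by rw [hα]; positivity
  have hβ0 : 0 < β := by rw [hβ]; positivity
  have hαβ : α + β = 1 := by rw [hα, hβ]; field_simp; ring
  have hpp : α * p₁ = β * p₂ := by rw [hα, hβ]; field_simp
  have hc₁ := h₁.rate_nonneg
  have hc₂ := h₂.rate_nonneg
  have eφ : ∀ x ∈ H₁.body, ∀ y ∈ H₂.body,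
      (α • φ₁ + β • φ₂) (x + y) = α * φ₁ x + β * φ₂ y := by
    intro x hx y hy
    simp [y₁ y hy, y₂ x hx]
  refine ⟨V₁ ⊔ V₂ ⊔ Submodule.span ℝ {p₁ • v₁ - p₂ • v₂}, α • φ₁ + β • φ₂, c₁ / α + c₂ / β,
    ?_, ?_, ?_, ?_, ?_, by positivity, ?_⟩
  · have e₁ : {x | x ∈ H₁.body ∧ ∃ y ∈ H₂.body, x + y ∈ ({v₁ + v₂} : Set (EucSp n))} =
        {v₁} := by
      ext x
      simp only [Set.mem_ofPred_eq, Set.mem_singleton_iff]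
      constructor
      · rintro ⟨hx, y, hy, hxy⟩
        ext j
        by_cases hj : j ∈ H₁.leaves
        · have := congrArg (fun u : EucSp n => u j) hxy
          simpa [HannerTree.coord_eq_zero (not_mem_right hH hj) hy,
            HannerTree.coord_eq_zero (not_mem_right hH hj) hb₂] using this
        · rw [HannerTree.coord_eq_zero hj hx, HannerTree.coord_eq_zero hj hb₁]
      · rintro rfl
        exact ⟨hb₁, v₂, hb₂, rfl⟩
    have e₂ : {y | y ∈ H₂.body ∧ ∃ x ∈ H₁.body, x + y ∈ ({v₁ + v₂} : Set (EucSp n))} =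
        {v₂} := by
      ext y
      simp only [Set.mem_ofPred_eq, Set.mem_singleton_iff]
      constructor
      · rintro ⟨hy, x, hx, hxy⟩
        ext j
        by_cases hj : j ∈ H₂.leaves
        · have := congrArg (fun u : EucSp n => u j) hxy
          simpa [HannerTree.coord_eq_zero (not_mem_left hH hj) hx,
            HannerTree.coord_eq_zero (not_mem_left hH hj) hb₁] using this
        · rw [HannerTree.coord_eq_zero hj hy, HannerTree.coord_eq_zero hj hb₂]
      · rintro rfl
        exact ⟨hb₂, v₁, hb₁, rfl⟩
    rw [faceAff]
    simp only [e₁, e₂, if_neg (body_ne_singleton (nodup_left hH) hv₁),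
      if_neg (body_ne_singleton (nodup_right hH) hv₂), setDim_singleton, setCentroid_singleton,
      Nat.cast_zero, sub_zero, ← hp₁, ← hp₂]
    rw [h₁.faceAff_eq, h₂.faceAff_eq, singleton_add_coe_add, add_assoc, ← Submodule.coe_sup]
  · have h1 : V₁ ≤ LinearMap.ker (α • φ₁ + β • φ₂) := fun x hx => by
      simp [h₁.map_eq_zero x hx, z₂ x (h₁.coord_eq_zero x hx)]
    have h2 : V₂ ≤ LinearMap.ker (α • φ₁ + β • φ₂) := fun x hx => by
      simp [h₂.map_eq_zero x hx, z₁ x (h₂.coord_eq_zero x hx)]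
    have h3 : Submodule.span ℝ {p₁ • v₁ - p₂ • v₂} ≤ LinearMap.ker (α • φ₁ + β • φ₂) := by
      rw [Submodule.span_singleton_le_iff_mem, LinearMap.mem_ker]
      simp only [LinearMap.add_apply, LinearMap.smul_apply, map_sub, map_smul, h₁.map_vertex,
        h₂.map_vertex, y₁ _ hb₂, y₂ _ hb₁, smul_eq_mul]
      linarith
    exact fun x hx => sup_le (sup_le h1 h2) h3 hx
  · intro x hx j hj
    simp only [leaves, List.mem_append, not_or] at hj
    obtain ⟨u, hu, w, hw, rfl⟩ := Submodule.mem_sup.1 hx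
    obtain ⟨y, hy, y', hy', rfl⟩ := Submodule.mem_sup.1 hu
    obtain ⟨a, rfl⟩ := Submodule.mem_span_singleton.1 hw
    simp [h₁.coord_eq_zero y hy j hj.1, h₂.coord_eq_zero y' hy' j hj.2,
      HannerTree.coord_eq_zero hj.1 hb₁, HannerTree.coord_eq_zero hj.2 hb₂]
  · rw [eφ _ hb₁ _ hb₂, h₁.map_vertex, h₂.map_vertex]
    linarith
  · intro x hx
    simp [h₁.map_eq_zero_of_coord x fun j hj => hx j (by simp [leaves, hj]),
      h₂.map_eq_zero_of_coord x fun j hj => hx j (by simp [leaves, hj])]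
  · intro x hx
    obtain ⟨x₁, hx₁, x₂, hx₂, rfl⟩ := mem_sumInf_body.1 hx
    rw [eφ _ hx₁ _ hx₂, add_sub_add_comm]
    have u₁ := h₁.map_le_one hx₁
    have u₂ := h₂.map_le_one hx₂
    calc ‖x₁ - v₁ + (x₂ - v₂)‖ ≤ c₁ * (1 - φ₁ x₁) + c₂ * (1 - φ₂ x₂) :=
          (norm_add_le _ _).trans (add_le_add (h₁.norm_sub_le _ hx₁) (h₂.norm_sub_le _ hx₂))
      _ = c₁ / α * (α * (1 - φ₁ x₁)) + c₂ / β * (β * (1 - φ₂ x₂)) := by field_simp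
      _ ≤ (c₁ / α + c₂ / β) * (α * (1 - φ₁ x₁) + β * (1 - φ₂ x₂)) := by
          have a1 : 0 ≤ c₁ / α * (β * (1 - φ₂ x₂)) := by positivity
          have a2 : 0 ≤ c₂ / β * (α * (1 - φ₁ x₁)) := by positivity
          linarith
      _ = _ := by linear_combination (c₁ / α + c₂ / β) * hαβ

lemma exists_exposes {H : HannerTree n} (hH : H.leaves.Nodup) {v : EucSp n} (hv : v ∈ H.verts) :
    ∃ V φ c, H.Exposes v V φ c := by
  induction H generalizing v with
  | interval i =>
    have key : ∀ s : ℝ, s = 1 ∨ s = -1 → v = s • EuclideanSpace.single i (1 : ℝ) →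
        ∃ V φ c, (interval i).Exposes v V φ c := by
      rintro s hs rfl
      exact ⟨_, _, _, exposes_interval hs⟩
    rcases hv with h | h
    · exact key (-1) (Or.inr rfl) (by simpa using h)
    · exact key 1 (Or.inl rfl) (by simpa using h)
  | sumOne H₁ H₂ ih₁ ih₂ =>
    rcases hv with h | h
    · obtain ⟨V, φ, c, hE⟩ := ih₁ (nodup_left hH) h
      obtain ⟨c', h'⟩ := hE.sumOne_left hH (H₁.verts_subset_body h)
      exact ⟨_, _, _, h'⟩
    · obtain ⟨V, φ, c, hE⟩ := ih₂ (nodup_right hH) h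
      obtain ⟨c', h'⟩ := hE.sumOne_right hH (H₂.verts_subset_body h)
      exact ⟨_, _, _, h'⟩
  | sumInf H₁ H₂ ih₁ ih₂ =>
    obtain ⟨v₁, hv₁, v₂, hv₂, rfl⟩ := hv
    obtain ⟨V₁, φ₁, c₁, h₁⟩ := ih₁ (nodup_left hH) hv₁
    obtain ⟨V₂, φ₂, c₂, h₂⟩ := ih₂ (nodup_right hH) hv₂
    exact h₁.sumInf hH hv₁ h₂ hv₂

lemma isFaceOf_singleton {H : HannerTree n} (hH : H.leaves.Nodup) {v : EucSp n}
    (hv : v ∈ H.verts) : IsFaceOf H.body {v} := by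
  obtain ⟨V, φ, c, h⟩ := exists_exposes hH hv
  have hvb := H.verts_subset_body hv
  refine ⟨fun _ => ⟨LinearMap.toContinuousLinearMap φ, ?_⟩, Set.singleton_nonempty _,
    body_ne_singleton hH hv⟩
  ext x
  simp only [Set.mem_singleton_iff, Set.mem_ofPred_eq, LinearMap.coe_toContinuousLinearMap']
  constructor
  · rintro rfl
    exact ⟨hvb, fun y hy => by linarith [h.map_le_one hy, h.map_vertex]⟩
  · rintro ⟨hx, hmax⟩
    have h1 := hmax v hvb
    rw [h.map_vertex] at h1
    exact sub_eq_zero.1 (norm_le_zero_iff.1 ((h.norm_sub_le x hx).trans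
      (mul_nonpos_of_nonneg_of_nonpos h.rate_nonneg (by linarith))))

end HannerTree

/-! ### Two facts on convex sets containing a ball. -/

section Convex

variable {E : Type*} [NormedAddCommGroup E] [NormedSpace ℝ E]

/-- Cancellation of a ball in an inclusion of convex sets. -/
lemma Convex.closedBall_subset_of_forall_dist_le {P : Set E} (hP : Convex ℝ P)
    (hc : IsClosed P) {r s : ℝ} (hr : 0 ≤ r) (hs : 0 ≤ s)
    (h : ∀ x, ‖x‖ ≤ r + s → ∃ y ∈ P, ‖x - y‖ ≤ s) : Metric.closedBall 0 r ⊆ P := by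
  intro q hq
  by_contra hqP
  rw [mem_closedBall_zero_iff] at hq
  obtain ⟨f, u, hf, hu⟩ := geometric_hahn_banach_closed_point hP hc hqP
  have hbound : ∀ x, ‖x‖ ≤ r + s → f x ≤ u + s * ‖f‖ := by
    intro x hx
    obtain ⟨y, hy, hxy⟩ := h x hx
    have h1 : f (x - y) ≤ s * ‖f‖ := by
      refine (le_abs_self _).trans ((f.le_opNorm _).trans ?_)
      rw [mul_comm]
      gcongr
    rw [map_sub] at h1
    linarith [hf y hy]
  -- As `x` ranges over the ball of radius `r + s`, the supremum of `f` is `(r + s)‖f‖`. Cancelling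
  -- `s‖f‖` leaves `r‖f‖ ≤ u`, although `f q > u`.
  have hnorm : (r + s) * ‖f‖ ≤ u + s * ‖f‖ := by
    rcases (add_nonneg hr hs).eq_or_lt with h0 | h0
    · rw [← h0, zero_mul]
      simpa using hbound 0 (by simpa using h0.le)
    · have hb : ∀ x, ‖x‖ ≤ r + s → |f x| ≤ u + s * ‖f‖ := fun x hx => by
        rw [abs_le]
        refine ⟨?_, hbound x hx⟩
        have := hbound (-x) (by simpa using hx)
        rw [map_neg] at this
        linarith
      rw [mul_comm, ← le_div_iff₀ h0]
      refine f.opNorm_le_of_unit_norm (div_nonneg ?_ h0.le) fun x hx => ?_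
      · exact (abs_nonneg _).trans (hb 0 (by simpa using h0.le))
      · have := hb ((r + s) • x) (by rw [norm_smul, hx, Real.norm_of_nonneg h0.le, mul_one])
        rw [map_smul, smul_eq_mul, abs_mul, abs_of_pos h0] at this
        rwa [le_div_iff₀ h0, mul_comm]
  have : f q ≤ r * ‖f‖ := by
    refine (le_abs_self _).trans ((f.le_opNorm _).trans ?_)
    rw [mul_comm]
    gcongr
  linarith

/-- The point is the convex combination of `y` and `ε⁻¹ z` with weights `1 / (1 + ε)` and `ε / (1 +
ε)`. This turns additive errors into dilations. -/
lemma Convex.inv_smul_add_mem {H : Set E} (hH : Convex ℝ H) {ρ : ℝ}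
    (hb : Metric.closedBall 0 ρ ⊆ H) {y z : E} (hy : y ∈ H) {ε : ℝ} (hε : 0 ≤ ε)
    (hz : ‖z‖ ≤ ε * ρ) : (1 + ε)⁻¹ • (y + z) ∈ H := by
  rcases hε.eq_or_lt with rfl | hε
  · have : z = 0 := by simpa using hz
    simpa [this] using hy
  · have hz' : ε⁻¹ • z ∈ H := hb (by
      rw [mem_closedBall_zero_iff, norm_smul, Real.norm_of_nonneg (by positivity),
        inv_mul_le_iff₀ hε]
      exact hz)
    have := hH hy hz' (by positivity : 0 ≤ (1 + ε)⁻¹) (by positivity : 0 ≤ ε * (1 + ε)⁻¹)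
      (by field_simp)
    convert this using 1
    rw [smul_smul, smul_add]
    congr 2
    field_simp

end Convex

/-! ### Tangent dilates and the points `x_F`. -/

section Tangent

variable {n : ℕ}

lemma neg_interior_eq {K : Set (EucSp n)} (hK : -K = K) : -interior K = interior K :=
  ((Homeomorph.neg (EucSp n)).preimage_interior K).trans (congrArg interior hK)

lemma neg_frontier_eq {K : Set (EucSp n)} (hK : -K = K) : -frontier K = frontier K :=
  ((Homeomorph.neg (EucSp n)).preimage_frontier K).trans (congrArg frontier hK)

lemma IsSymmConvexBody.zero_mem_interior {K : Set (EucSp n)} (hK : IsSymmConvexBody K) :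
    (0 : EucSp n) ∈ interior K := by
  obtain ⟨x, hx⟩ := hK.nonempty_interior
  have hx' : -x ∈ interior K := by
    rw [← neg_interior_eq hK.symm]; simpa using hx
  have := hK.convex.interior hx hx' (by norm_num : (0 : ℝ) ≤ 1 / 2)
    (by norm_num : (0 : ℝ) ≤ 1 / 2) (by norm_num)
  simpa using this

lemma IsSymmConvexBody.smul_mem_interior {K : Set (EucSp n)} (hK : IsSymmConvexBody K)
    {x : EucSp n} (hx : x ∈ K) {t : ℝ} (h0 : 0 ≤ t) (h1 : t < 1) : t • x ∈ interior K := by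
  have := hK.convex.combo_interior_self_mem_interior hK.zero_mem_interior hx
    (a := 1 - t) (b := t) (by linarith) h0 (by ring)
  simpa using this

/-- An affine subspace missing the origin has a dilate tangent to `K`. -/
lemma IsSymmConvexBody.exists_isXPoint {K : Set (EucSp n)} (hK : IsSymmConvexBody K)
    {a : EucSp n} {V : Submodule ℝ (EucSp n)} {φ : EucSp n →ₗ[ℝ] ℝ} (hV : ∀ x ∈ V, φ x = 0)
    (ha : φ a = 1) (c : EucSp n) : ∃ x, IsXPoint K ({a} + (V : Set (EucSp n))) c x := by
  have hφ : Continuous φ := φ.continuous_of_finiteDimensional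
  obtain ⟨U, hU⟩ : ∃ U : Submodule ℝ (EucSp n), U = Submodule.span ℝ {a} ⊔ V := ⟨_, rfl⟩
  have haU : a ∈ U := hU ▸ Submodule.mem_sup_left (Submodule.mem_span_singleton_self a)
  have hUdec : ∀ x ∈ U, ∃ w ∈ V, x = φ x • a + w := by
    intro x hx
    rw [hU] at hx
    obtain ⟨y, hy, w, hw, rfl⟩ := Submodule.mem_sup.1 hx
    obtain ⟨s, rfl⟩ := Submodule.mem_span_singleton.1 hy
    exact ⟨w, hw, by simp [ha, hV w hw]⟩
  have hcomp : IsCompact (K ∩ U) := hK.isCompact.inter_right U.closed_of_finiteDimensional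
  -- The tangent dilate is found by maximising `φ` on the section of `K` by `U = span{a} + V`.
  -- Inside `U` the set `t({a} + V)` is the level set `φ = t`, so the maximum is the right `t`.
  obtain ⟨x₀, hx₀, hmax⟩ := hcomp.exists_isMaxOn
    ⟨0, interior_subset hK.zero_mem_interior, U.zero_mem⟩ hφ.continuousOn
  obtain ⟨t, ht⟩ : ∃ t, t = φ x₀ := ⟨_, rfl⟩
  have mem_iff : ∀ t : ℝ, 0 < t → ∀ x, x ∈ t • ({a} + (V : Set (EucSp n))) ↔ x ∈ U ∧ φ x = t := by
    intro t ht x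
    constructor
    · rintro ⟨y, ⟨a', rfl, w, hw, rfl⟩, rfl⟩
      refine ⟨U.smul_mem _ (U.add_mem haU (hU ▸ Submodule.mem_sup_right hw)), ?_⟩
      simp [ha, hV w hw]
    · rintro ⟨hx, rfl⟩
      obtain ⟨w, hw, e⟩ := hUdec x hx
      refine ⟨a + (φ x)⁻¹ • w, ⟨a, rfl, _, V.smul_mem _ hw, rfl⟩, ?_⟩
      simp only [smul_add, smul_smul, mul_inv_cancel₀ ht.ne', one_smul]
      exact e.symm
  have grow : ∀ y ∈ interior K, ∃ η : ℝ, 0 < η ∧ (1 + η) • y ∈ K := by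
    intro y hy
    have hcont : Filter.Tendsto (fun η : ℝ => (1 + η) • y) (nhdsWithin 0 (Set.Ioi 0))
        (nhds y) := by
      have : Continuous fun η : ℝ => (1 + η) • y := by fun_prop
      simpa using (this.tendsto 0).mono_left nhdsWithin_le_nhds
    obtain ⟨η, h1, h2⟩ := ((hcont.eventually (isOpen_interior.mem_nhds hy)).and
      self_mem_nhdsWithin).exists
    exact ⟨η, h2, interior_subset h1⟩
  have htpos : 0 < t := by
    have hcont : Filter.Tendsto (fun η : ℝ => η • a) (nhdsWithin 0 (Set.Ioi 0)) (nhds 0) := by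
      have : Continuous fun η : ℝ => η • a := by fun_prop
      simpa using (this.tendsto 0).mono_left nhdsWithin_le_nhds
    obtain ⟨η, h1, h2⟩ := ((hcont.eventually (isOpen_interior.mem_nhds
      hK.zero_mem_interior)).and self_mem_nhdsWithin).exists
    have h2 : 0 < η := h2
    have : φ (η • a) ≤ φ x₀ := hmax ⟨interior_subset h1, U.smul_mem η haU⟩
    simp only [map_smul, ha, smul_eq_mul, mul_one] at this
    rw [ht]
    exact h2.trans_le this
  have hdisj : Disjoint (t • ({a} + (V : Set (EucSp n)))) (interior K) := by
    rw [Set.disjoint_left]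
    intro y hy hyi
    obtain ⟨hyU, hyt⟩ := (mem_iff t htpos y).1 hy
    obtain ⟨η, hη, hyK⟩ := grow y hyi
    have h2 : φ ((1 + η) • y) ≤ φ x₀ := hmax ⟨hyK, U.smul_mem _ hyU⟩
    rw [map_smul, hyt, smul_eq_mul, ← ht] at h2
    nlinarith
  have hx₀A := (mem_iff t htpos x₀).2 ⟨hx₀.2, ht.symm⟩
  have hA : IsClosed (t • ({a} + (V : Set (EucSp n)))) := by
    have : t • ({a} + (V : Set (EucSp n))) = (U : Set (EucSp n)) ∩ φ ⁻¹' {t} := by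
      ext x; exact mem_iff t htpos x
    rw [this]
    exact U.closed_of_finiteDimensional.inter (isClosed_singleton.preimage hφ)
  have hfr : IsCompact ((t • ({a} + (V : Set (EucSp n)))) ∩ frontier K) :=
    (hK.isCompact.of_isClosed_subset isClosed_frontier
      hK.isCompact.isClosed.frontier_subset).inter_left hA
  obtain ⟨x, hx, hmin⟩ := hfr.exists_isMinOn ⟨x₀, hx₀A, subset_closure hx₀.1,
    Set.disjoint_left.1 hdisj hx₀A⟩ (f := fun y => dist y c) (by fun_prop)
  exact ⟨x, t, htpos, ⟨⟨x₀, hx₀A, hx₀.1⟩, hdisj⟩, hx, fun y hy => hmin hy⟩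

lemma IsXPoint.mem {K A : Set (EucSp n)} (hK : IsClosed K) {c x : EucSp n}
    (h : IsXPoint K A c x) : x ∈ K := by
  obtain ⟨t, -, -, hx, -⟩ := h
  exact hK.frontier_subset hx.2

/-- Bounds for the factor `t` of the tangent dilate `t A`, when `K` and `H` agree up to the factor
`1 + ε`. -/
lemma IsXPoint.exists_tangent {K H : Set (EucSp n)} (hK : IsSymmConvexBody K)
    {a : EucSp n} {V : Submodule ℝ (EucSp n)} {c x : EucSp n}
    (h : IsXPoint K ({a} + (V : Set (EucSp n))) c x) {ε : ℝ} (hε : 0 ≤ ε)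
    (hKH : ∀ x ∈ K, (1 + ε)⁻¹ • x ∈ H) (hHK : ∀ x ∈ H, (1 + ε)⁻¹ • x ∈ K)
    (haH : a ∈ H) {φ : EucSp n →ₗ[ℝ] ℝ} (hV : ∀ x ∈ V, φ x = 0) (ha : φ a = 1)
    (hφ : ∀ x ∈ H, φ x ≤ 1) :
    ∃ t : ℝ, (1 + ε)⁻¹ ≤ t ∧ t ≤ 1 + ε ∧ (∃ w ∈ V, x = t • a + w) ∧
      ∃ f : EucSp n →ₗ[ℝ] ℝ, (∀ y ∈ K, f y ≤ 1) ∧ f a = t⁻¹ ∧ ∀ w ∈ V, f w = 0 := by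
  have hxK := h.mem hK.isCompact.isClosed
  obtain ⟨t, ht, ⟨-, hdisj⟩, hx, -⟩ := h
  obtain ⟨w, hw, hxw⟩ : ∃ w ∈ V, t • (a + w) = x := by
    obtain ⟨_, ⟨_, rfl, w, hw, rfl⟩, rfl⟩ := hx.1
    exact ⟨w, hw, rfl⟩
  subst hxw
  simp only [smul_add] at hxK hx ⊢
  have h1ε : 0 < 1 + ε := by linarith
  refine ⟨t, ?_, ?_, ⟨t • w, V.smul_mem _ hw, rfl⟩, ?_⟩
  · by_contra hlt
    push Not at hlt
    have hlt' : t * (1 + ε) < 1 := by rwa [← one_div, lt_div_iff₀ h1ε] at hlt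
    have := hK.smul_mem_interior (hHK a haH) (by positivity) hlt'
    rw [smul_smul, mul_assoc, mul_inv_cancel₀ h1ε.ne', mul_one] at this
    exact Set.disjoint_left.1 hdisj ⟨a, ⟨a, rfl, 0, V.zero_mem, add_zero _⟩, rfl⟩ this
  · have := hφ _ (hKH _ hxK)
    rw [map_smul, map_add, map_smul, map_smul, ha, hV w hw, smul_zero, add_zero, smul_eq_mul,
      smul_eq_mul, mul_one, inv_mul_le_iff₀ h1ε, mul_one] at this
    exact this
  · have hconv : Convex ℝ (t • ({a} + (V : Set (EucSp n)))) :=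
      ((convex_singleton a).add V.convex).smul t
    -- The functional separates the interior of `K` from the tangent dilate. Being bounded below on
    -- an affine subspace, it vanishes on `V`; tangency gives `f (t • a) = u`, so it only needs
    -- division by `u`.
    obtain ⟨f, u, hf, hu⟩ := geometric_hahn_banach_open hK.convex.interior isOpen_interior hconv
      hdisj.symm
    have hu0 : 0 < u := by simpa using hf 0 hK.zero_mem_interior
    have hfK : ∀ y ∈ K, f y ≤ u := by
      intro y hy
      have hcl : y ∈ closure (interior K) := by
        rw [hK.convex.closure_interior_eq_closure_of_nonempty_interior hK.nonempty_interior]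
        exact subset_closure hy
      exact closure_minimal (fun z hz => (hf z hz).le)
        (isClosed_le f.continuous continuous_const) hcl
    have hA : ∀ w ∈ V, u ≤ t * f a + f w := by
      intro w hw
      have := hu (t • (a + t⁻¹ • w)) ⟨_, ⟨a, rfl, _, V.smul_mem _ hw, rfl⟩, rfl⟩
      simpa [smul_smul, mul_inv_cancel₀ ht.ne', mul_add] using this
    have hV0 : ∀ w ∈ V, f w = 0 := by
      intro w hw
      by_contra hne
      have := hA (((u - 1 - t * f a) / f w) • w) (V.smul_mem _ hw)
      rw [map_smul, smul_eq_mul, div_mul_cancel₀ _ hne] at this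
      linarith
    have hta : t * f a = u := by
      apply le_antisymm
      · have := hfK _ hxK
        simpa [hV0 w hw] using this
      · simpa using hA 0 V.zero_mem
    refine ⟨u⁻¹ • f.toLinearMap, fun y hy => ?_, ?_, fun w hw => ?_⟩
    · simpa [inv_mul_le_iff₀ hu0] using hfK y hy
    · simp only [LinearMap.smul_apply, ContinuousLinearMap.coe_coe, smul_eq_mul]
      rw [← hta]
      have : f a ≠ 0 := by rintro h; rw [h, mul_zero] at hta; exact hu0.ne hta
      field_simp
    · simp [hV0 w hw]

lemma smul_inter_frontier_of_isTangentTo {A K : Set (EucSp n)} (hK : IsClosed K)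
    (h : IsTangentTo A K) : A ∩ frontier K = A ∩ K := by
  ext x
  refine ⟨fun hx => ⟨hx.1, hK.frontier_subset hx.2⟩,
    fun hx => ⟨hx.1, subset_closure hx.2, Set.disjoint_left.1 h.2 hx.1⟩⟩

/-- If `t < s`, shrinking a common point of `s • A` and `K` by `t / s < 1` puts it into the interior
of `K`. -/
lemma IsTangentTo.le_of_smul {A K : Set (EucSp n)} (hK : IsSymmConvexBody K) {s t : ℝ}
    (hs : 0 < s) (ht : 0 < t) (h₁ : IsTangentTo (s • A) K) (h₂ : IsTangentTo (t • A) K) :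
    s ≤ t := by
  by_contra! hlt
  obtain ⟨_, ⟨a, ha, rfl⟩, haK⟩ := h₁.1
  have := hK.smul_mem_interior haK (t := t / s) (by positivity) ((div_lt_one hs).2 hlt)
  simp only [smul_smul, div_mul_cancel₀ _ hs.ne'] at this
  exact Set.disjoint_left.1 h₂.2 ⟨a, ha, rfl⟩ this

/-- The tangency factor is unique, and the midpoint of two distinct nearest points of a convex set
would be strictly nearer. Hence every face yields at most one `x_F`. -/
lemma IsXPoint.unique {K A : Set (EucSp n)} (hK : IsSymmConvexBody K) (hA : Convex ℝ A)
    {c x y : EucSp n} (hx : IsXPoint K A c x) (hy : IsXPoint K A c y) : x = y := by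
  obtain ⟨s, hs, hsT, hxs, hxmin⟩ := hx
  obtain ⟨t, ht, htT, hyt, hymin⟩ := hy
  obtain rfl : s = t := le_antisymm (hsT.le_of_smul hK hs ht htT) (htT.le_of_smul hK ht hs hsT)
  have hd : dist x c = dist y c := le_antisymm (hxmin y hyt) (hymin x hxs)
  rw [smul_inter_frontier_of_isTangentTo hK.isCompact.isClosed hsT] at hxs hyt hxmin hymin
  by_contra hne
  have hmid : midpoint ℝ x y ∈ s • A ∩ K :=
    ((hA.smul s).inter hK.convex).midpoint_mem hxs hyt
  have h1 := hxmin _ hmid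
  have h2 : dist (midpoint ℝ x y) c < dist x c := by
    rw [dist_eq_norm, dist_eq_norm] at hd ⊢
    have := (norm_midpoint_lt_iff hd).2 fun h => hne (sub_left_injective h)
    have e : midpoint ℝ x y - c = (1 / 2 : ℝ) • (x - c + (y - c)) := by
      rw [midpoint_eq_smul_add, invOf_eq_inv]
      module
    rwa [e]
  exact absurd h1 (not_le.2 h2)

lemma IsXPoint.neg {K A : Set (EucSp n)} (hK : -K = K) {c x : EucSp n} (h : IsXPoint K A c x) :
    IsXPoint K (-A) (-c) (-x) := by
  have hint := neg_interior_eq hK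
  have hfr := neg_frontier_eq hK
  obtain ⟨t, ht, ⟨hne, hdisj⟩, hx, hmin⟩ := h
  have e : t • (-A) = -(t • A) := by simp
  refine ⟨t, ht, ⟨?_, ?_⟩, ?_, ?_⟩
  · obtain ⟨y, hy, hyK⟩ := hne
    exact ⟨-y, by rw [e]; simpa using hy, by rw [← hK]; simpa using hyK⟩
  · rw [e, Set.disjoint_left]
    intro y hy hyK
    rw [← hint] at hyK
    exact Set.disjoint_left.1 hdisj hy hyK
  · rw [e, ← hfr]; simpa using hx
  · intro y hy
    rw [e, ← hfr] at hy
    have := hmin (-y) hy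
    rwa [dist_neg_neg, ← neg_neg y, dist_neg_neg]

end Tangent

/-! ### Symmetry and finiteness of the set of points `x_F`. -/

variable {n : ℕ}

lemma setDim_neg (A : Set (EucSp n)) : setDim (-A) = setDim A := by
  have : vectorSpan ℝ (-A) = vectorSpan ℝ A := by
    have h : (-A) -ᵥ (-A) = A -ᵥ A := by
      ext x
      simp only [Set.mem_vsub, vsub_eq_sub]
      constructor
      · rintro ⟨a, ha, b, hb, rfl⟩
        exact ⟨-b, hb, -a, ha, by abel⟩
      · rintro ⟨a, ha, b, hb, rfl⟩
        exact ⟨-b, by simpa using hb, -a, by simpa using ha, by abel⟩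
    rw [vectorSpan, vectorSpan, h]
  rw [setDim, setDim, this]

lemma setCentroid_neg (A : Set (EucSp n)) : setCentroid (-A) = -setCentroid A := by
  rw [setCentroid, setCentroid, setDim_neg, MeasureTheory.setAverage_eq,
    MeasureTheory.setAverage_eq]
  have hmp : MeasureTheory.MeasurePreserving (fun x : EucSp n => -x)
      (MeasureTheory.Measure.hausdorffMeasure (setDim A : ℝ))
      (MeasureTheory.Measure.hausdorffMeasure (setDim A : ℝ)) :=
    (IsometryEquiv.neg (EucSp n)).measurePreserving_hausdorffMeasure _
  have hemb : MeasurableEmbedding (fun x : EucSp n => -x) :=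
    (Homeomorph.neg (EucSp n)).measurableEmbedding
  have h1 : (MeasureTheory.Measure.hausdorffMeasure (setDim A : ℝ)).real (-A) =
      (MeasureTheory.Measure.hausdorffMeasure (setDim A : ℝ)).real A := by
    rw [MeasureTheory.Measure.real, MeasureTheory.Measure.real,
      ← hmp.measure_preimage_emb hemb A]
    rfl
  have h2 := hmp.setIntegral_preimage_emb hemb (fun x => -x) A
  simp only [neg_neg] at h2
  rw [h1, ← smul_neg, ← MeasureTheory.integral_neg]
  exact congrArg _ h2

namespace HannerTree

lemma convex_faceAff (H : HannerTree n) {F : Set (EucSp n)} (hF : Convex ℝ F) :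
    Convex ℝ (H.faceAff F) := by
  induction H generalizing F with
  | interval i => exact hF
  | sumOne H₁ H₂ ih₁ ih₂ =>
    have c₁ := ih₁ (hF.inter H₁.convex_body)
    have c₂ := ih₂ (hF.inter H₂.convex_body)
    rw [faceAff]
    split_ifs
    · exact c₁.add (Submodule.convex _)
    · exact (Submodule.convex _).add c₂
    · exact (c₁.smul _).add (c₂.smul _)
  | sumInf H₁ H₂ ih₁ ih₂ =>
    have c₁ : Convex ℝ {x | x ∈ H₁.body ∧ ∃ y ∈ H₂.body, x + y ∈ F} := by
      rintro x ⟨hx, y, hy, hxy⟩ x' ⟨hx', y', hy', hxy'⟩ a b ha hb hab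
      refine ⟨H₁.convex_body hx hx' ha hb hab, _, H₂.convex_body hy hy' ha hb hab, ?_⟩
      convert hF hxy hxy' ha hb hab using 1
      module
    have c₂ : Convex ℝ {y | y ∈ H₂.body ∧ ∃ x ∈ H₁.body, x + y ∈ F} := by
      rintro y ⟨hy, x, hx, hxy⟩ y' ⟨hy', x', hx', hxy'⟩ a b ha hb hab
      refine ⟨H₂.convex_body hy hy' ha hb hab, _, H₁.convex_body hx hx' ha hb hab, ?_⟩
      convert hF hxy hxy' ha hb hab using 1
      module
    rw [faceAff]
    split_ifs
    · exact ih₁ c₁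
    · exact ih₂ c₂
    · exact ((ih₁ c₁).add (ih₂ c₂)).add (Submodule.convex _)

lemma neg_eq_body_iff {H : HannerTree n} {F : Set (EucSp n)} : -F = H.body ↔ F = H.body := by
  rw [← neg_inj, neg_neg, H.neg_body]

lemma faceAff_neg (H : HannerTree n) (F : Set (EucSp n)) :
    H.faceAff (-F) = -H.faceAff F := by
  induction H generalizing F with
  | interval i => rfl
  | sumOne H₁ H₂ ih₁ ih₂ =>
    have e₁ : -F ∩ H₁.body = -(F ∩ H₁.body) := by rw [Set.inter_neg, neg_body]
    have e₂ : -F ∩ H₂.body = -(F ∩ H₂.body) := by rw [Set.inter_neg, neg_body]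
    rw [faceAff, faceAff]
    simp only [e₁, e₂, setDim_neg, ih₁, ih₂, Set.neg_eq_empty]
    split_ifs
    · rw [neg_add, Submodule.neg_coe]
    · rw [neg_add, Submodule.neg_coe]
    · rw [neg_add, Set.smul_set_neg, Set.smul_set_neg]
  | sumInf H₁ H₂ ih₁ ih₂ =>
    have e₁ : {x | x ∈ H₁.body ∧ ∃ y ∈ H₂.body, x + y ∈ -F} =
        -{x | x ∈ H₁.body ∧ ∃ y ∈ H₂.body, x + y ∈ F} := by
      ext x
      simp only [Set.mem_neg, Set.mem_ofPred_eq]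
      constructor
      · rintro ⟨hx, y, hy, h⟩
        exact ⟨neg_mem_body hx, -y, neg_mem_body hy, by rwa [← neg_add]⟩
      · rintro ⟨hx, y, hy, h⟩
        exact ⟨by simpa using neg_mem_body hx, -y, neg_mem_body hy, by
          rwa [neg_add, neg_neg]⟩
    have e₂ : {y | y ∈ H₂.body ∧ ∃ x ∈ H₁.body, x + y ∈ -F} =
        -{y | y ∈ H₂.body ∧ ∃ x ∈ H₁.body, x + y ∈ F} := by
      ext x
      simp only [Set.mem_neg, Set.mem_ofPred_eq]
      constructor
      · rintro ⟨hx, y, hy, h⟩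
        exact ⟨neg_mem_body hx, -y, neg_mem_body hy, by rwa [← neg_add]⟩
      · rintro ⟨hx, y, hy, h⟩
        exact ⟨by simpa using neg_mem_body hx, -y, neg_mem_body hy, by
          rwa [neg_add, neg_neg]⟩
    have sp : ∀ v : EucSp n, (Submodule.span ℝ {-v} : Set (EucSp n)) =
        -(Submodule.span ℝ {v} : Set (EucSp n)) := fun v => by
      rw [Submodule.neg_coe, ← Set.neg_singleton, Submodule.span_neg]
    rw [faceAff, faceAff]
    simp only [e₁, e₂, setDim_neg, setCentroid_neg, ih₁, ih₂, neg_eq_body_iff]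
    split_ifs
    · rfl
    · rfl
    · rw [neg_add, neg_add, ← sp]
      congr 4
      module

/-- A face is the closed convex hull of its extreme points, and these are extreme points of the
polytope, hence among the finitely many `verts`. -/
lemma finite_faces (H : HannerTree n) : {F | IsFaceOf H.body F}.Finite := by
  refine Set.Finite.of_finite_image (f := fun F => Set.extremePoints ℝ F)
    (H.verts_finite.powerset.subset ?_) ?_
  · rintro _ ⟨F, hF, rfl⟩
    have := hF.1.isExtreme.extremePoints_subset_extremePoints
    refine this.trans ?_
    rw [← H.convexHull_verts]
    exact extremePoints_convexHull_subset
  · intro F hF G hG h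
    have key : ∀ F, IsFaceOf H.body F → closure (convexHull ℝ (Set.extremePoints ℝ F)) = F :=
      fun F hF => closure_convexHull_extremePoints (hF.1.isCompact H.isCompact_body)
        (hF.1.convex H.convex_body)
    rw [← key F hF, ← key G hG]
    exact congrArg (fun s => closure (convexHull ℝ s)) h

lemma isFaceOf_neg {H : HannerTree n} {F : Set (EucSp n)} (hF : IsFaceOf H.body F) :
    IsFaceOf H.body (-F) := by
  refine ⟨fun _ => ?_, hF.2.1.neg, fun h => hF.2.2 (neg_eq_body_iff.1 h)⟩
  obtain ⟨l, hl⟩ := hF.1 hF.2.1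
  refine ⟨-l, ?_⟩
  ext x
  rw [Set.mem_neg, hl]
  simp only [Set.mem_ofPred_eq, map_neg, neg_apply]
  constructor
  · rintro ⟨hx, h⟩
    refine ⟨by simpa using neg_mem_body hx, fun y hy => ?_⟩
    simpa using h (-y) (neg_mem_body hy)
  · rintro ⟨hx, h⟩
    refine ⟨neg_mem_body hx, fun y hy => ?_⟩
    simpa using h (-y) (neg_mem_body hy)

/-- The points whose convex hull is `xPointHull H K`. -/
def xPoints (H : HannerTree n) (K : Set (EucSp n)) : Set (EucSp n) :=
  {x | ∃ F, IsFaceOf H.body F ∧ IsXPoint K (H.faceAff F) (setCentroid F) x}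

lemma xPoints_finite (H : HannerTree n) {K : Set (EucSp n)} (hK : IsSymmConvexBody K) :
    (H.xPoints K).Finite := by
  have : H.xPoints K = ⋃ F ∈ {F | IsFaceOf H.body F},
      {x | IsXPoint K (H.faceAff F) (setCentroid F) x} := by
    ext x; simp [xPoints]
  rw [this]
  refine H.finite_faces.biUnion fun F hF => Set.Subsingleton.finite fun x hx y hy => ?_
  exact IsXPoint.unique hK (H.convex_faceAff (hF.1.convex H.convex_body)) hx hy

lemma neg_xPoints (H : HannerTree n) {K : Set (EucSp n)} (hK : -K = K) :
    -H.xPoints K = H.xPoints K := by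
  have key : ∀ x ∈ H.xPoints K, -x ∈ H.xPoints K := by
    rintro x ⟨F, hF, hx⟩
    refine ⟨-F, isFaceOf_neg hF, ?_⟩
    rw [faceAff_neg, setCentroid_neg]
    exact hx.neg hK
  ext x
  exact ⟨fun h => by simpa using key _ h, fun h => key x h⟩

lemma xPoints_subset (H : HannerTree n) {K : Set (EucSp n)} (hK : IsClosed K) :
    H.xPoints K ⊆ K := by
  rintro x ⟨F, -, hx⟩
  exact hx.mem hK

end HannerTree

/-! ### Position of `x_F` for coordinate faces and for vertices. -/

namespace HannerTree

/-- The point `x_F` of the coordinate face `F = {x i = 1}`, with a supporting functional of `K` that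
is constant on the tangent dilate of the affine subspace of `F`. -/
lemma exists_xPoint_coord {H : HannerTree n} (hH : H.IsStandard) {K : Set (EucSp n)}
    (hK : IsSymmConvexBody K) {ε : ℝ} (hε : 0 ≤ ε) (hKH : ∀ x ∈ K, (1 + ε)⁻¹ • x ∈ H.body)
    (hHK : ∀ x ∈ H.body, (1 + ε)⁻¹ • x ∈ K) (i : Fin n) :
    ∃ x ∈ H.xPoints K, ∃ f : EucSp n →ₗ[ℝ] ℝ, (1 + ε)⁻¹ ≤ x i ∧ x i ≤ 1 + ε ∧
      (∀ j ≠ i, ¬ H.Linked i j → x j = 0) ∧ (∀ j ≠ i, |x j| ≤ 2 * ε) ∧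
      (∀ y ∈ K, f y ≤ 1) ∧ f (EuclideanSpace.single i 1) = (x i)⁻¹ ∧
      (∀ j, H.Linked i j → f (EuclideanSpace.single j 1) = 0) ∧
      ∀ j ≠ i, |f (EuclideanSpace.single j 1)| ≤ 2 * ε := by
  obtain ⟨hnd, hall⟩ := hH
  have h1ε : 0 < 1 + ε := by linarith
  have hinv : 1 - ε ≤ (1 + ε)⁻¹ := by
    rw [← one_div, le_div_iff₀ h1ε]; nlinarith
  have hφ : ∀ x, (EuclideanSpace.proj i : EucSp n →L[ℝ] ℝ).toLinearMap x = x i := fun _ => rfl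
  have hV : ∀ x ∈ H.linkedSpan i, (EuclideanSpace.proj i : EucSp n →L[ℝ] ℝ).toLinearMap x = 0 :=
    fun x hx => coord_linkedSpan (not_linked_self hnd i) hx
  have hei : (EuclideanSpace.proj i : EucSp n →L[ℝ] ℝ).toLinearMap
      (EuclideanSpace.single i 1) = 1 := by simp
  obtain ⟨x, hx⟩ := hK.exists_isXPoint hV hei (setCentroid (H.coordFace i))
  obtain ⟨t, ht1, ht2, ⟨w, hw, hxw⟩, f, hf, hfi, hf0⟩ := hx.exists_tangent hK hε hKH hHK
    (single_mem_body (hall i)) hV hei fun y hy => (abs_le.1 (abs_coord_le_one hnd hy i)).2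
  have hxi : x i = t := by
    have := hV w hw
    rw [hφ] at this
    simp [hxw, this]
  have hxj : ∀ j ≠ i, ¬ H.Linked i j → x j = 0 := fun j hj hl => by
    simp [hxw, hj, coord_linkedSpan hl hw]
  have hxK : x ∈ K := hx.mem hK.isCompact.isClosed
  have ht0 : 0 < t := (inv_pos.2 h1ε).trans_le ht1
  refine ⟨x, ⟨_, isFaceOf_coordFace hnd (hall i), by rwa [faceAff_coordFace hnd (hall i)]⟩, f,
    hxi ▸ ht1, hxi ▸ ht2, hxj, fun j hj => ?_, hf, hxi ▸ hfi,
    fun j hj => hf0 _ (single_mem_linkedSpan hj), fun j hj => ?_⟩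
  · by_cases hl : H.Linked i j
    · have := abs_add_abs_le_one hnd hl (hKH x hxK)
      simp only [PiLp.smul_apply, smul_eq_mul, abs_mul, hxi, abs_of_pos (inv_pos.2 h1ε),
        abs_of_pos ht0, ← mul_add] at this
      rw [inv_mul_le_iff₀ h1ε] at this
      linarith
    · rw [hxj j hj hl, abs_zero]; positivity
  · by_cases hl : H.Linked i j
    · rw [hf0 _ (single_mem_linkedSpan hl), abs_zero]; positivity
    · have htinv : 1 - ε ≤ t⁻¹ := hinv.trans (inv_anti₀ ht0 ht2)
      -- For unlinked `j` both `eᵢ ± eⱼ` lie in `H`, so `f (eᵢ ± eⱼ) ≤ 1 + ε`, whereas `f eᵢ = t⁻¹ ≥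
      -- 1 - ε`.
      have key : ∀ u ∈ H.body, (∀ k, k ≠ j → u k = 0) → f u ≤ 2 * ε := by
        intro u hu huk
        have := hf _ (hHK _ (single_add_mem_body hnd (hall i) hu (huk i hj.symm)
          fun k hk => huk k (by rintro rfl; exact hl hk)))
        rw [map_smul, map_add, hfi, smul_eq_mul, inv_mul_le_iff₀ h1ε] at this
        linarith
      have hej := single_mem_body (hall j)
      have h1 := key _ hej fun k hk => by simp [hk]
      have h2 := key _ (neg_mem_body hej) fun k hk => by simp [hk]
      rw [map_neg] at h2
      exact abs_le.2 ⟨by linarith, h1⟩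

/-- The point `x_F` of a vertex `F = {v}` is close to `v`. -/
lemma exists_xPoint_vertex {H : HannerTree n} (hH : H.leaves.Nodup) {v : EucSp n}
    (hv : v ∈ H.verts) : ∃ C : ℝ, 0 ≤ C ∧ ∀ K : Set (EucSp n), IsSymmConvexBody K →
      ∀ ε : ℝ, 0 ≤ ε → ε ≤ 1 → (∀ x ∈ K, (1 + ε)⁻¹ • x ∈ H.body) →
      (∀ x ∈ H.body, (1 + ε)⁻¹ • x ∈ K) → ∃ x ∈ H.xPoints K, ‖v - x‖ ≤ C * ε := by
  obtain ⟨V, φ, c, h⟩ := exists_exposes hH hv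
  have hc := h.rate_nonneg
  have hvb := H.verts_subset_body hv
  refine ⟨4 * c + ‖v‖, by positivity, fun K hK ε hε hε1 hKH hHK => ?_⟩
  have h1ε : 0 < 1 + ε := by linarith
  have hinv : 1 - ε ≤ (1 + ε)⁻¹ := by
    rw [← one_div, le_div_iff₀ h1ε]; nlinarith
  have hinv1 : (1 + ε)⁻¹ ≤ 1 := inv_le_one_of_one_le₀ (by linarith)
  obtain ⟨x, hx⟩ := hK.exists_isXPoint h.map_eq_zero h.map_vertex (setCentroid {v})
  obtain ⟨t, ht1, -, ⟨w, hw, hxw⟩, -⟩ := hx.exists_tangent hK hε hKH hHK hvb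
    h.map_eq_zero h.map_vertex fun y hy => by linarith [h.map_le_one hy]
  refine ⟨x, ⟨_, isFaceOf_singleton hH hv, by rwa [h.faceAff_eq]⟩, ?_⟩
  have hxt : φ x = t := by simp [hxw, h.map_vertex, h.map_eq_zero w hw]
  have hxH := h.norm_sub_le _ (hKH x (hx.mem hK.isCompact.isClosed))
  rw [map_smul, hxt, smul_eq_mul] at hxH
  -- The scaled point `(1 + ε)⁻¹ x` of `H` has exposing value at least `(1 + ε)⁻²`, so the linear
  -- rate keeps it within `O(ε)` of `v`.
  have h2 : 1 - (1 + ε)⁻¹ * t ≤ 2 * ε := by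
    have : (1 + ε)⁻¹ * (1 + ε)⁻¹ ≤ (1 + ε)⁻¹ * t := by gcongr
    nlinarith [inv_pos.2 h1ε]
  have h3 : ‖(1 + ε)⁻¹ • x - v‖ ≤ c * (2 * ε) :=
    hxH.trans (mul_le_mul_of_nonneg_left h2 hc)
  have e : x - v = (1 + ε) • ((1 + ε)⁻¹ • x - v) + ε • v := by
    rw [smul_sub, smul_smul, mul_inv_cancel₀ h1ε.ne']
    module
  rw [norm_sub_rev, e]
  calc ‖(1 + ε) • ((1 + ε)⁻¹ • x - v) + ε • v‖
      ≤ (1 + ε) * ‖(1 + ε)⁻¹ • x - v‖ + ε * ‖v‖ := by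
        refine (norm_add_le _ _).trans_eq ?_
        rw [norm_smul, norm_smul, Real.norm_of_nonneg h1ε.le, Real.norm_of_nonneg hε]
    _ ≤ 2 * (c * (2 * ε)) + ε * ‖v‖ := by
        gcongr
        linarith
    _ = _ := by ring

/-- The estimate at the vertices passes to their hull because the `Cε`-neighbourhood of a convex set
is convex. The constant is a maximum over finitely many vertices. -/
lemma exists_near_xPointHull {H : HannerTree n} (hH : H.leaves.Nodup) :
    ∃ C : ℝ, 0 ≤ C ∧ ∀ K : Set (EucSp n), IsSymmConvexBody K →
      ∀ ε : ℝ, 0 ≤ ε → ε ≤ 1 → (∀ x ∈ K, (1 + ε)⁻¹ • x ∈ H.body) →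
      (∀ x ∈ H.body, (1 + ε)⁻¹ • x ∈ K) →
      ∀ y ∈ H.body, ∃ p ∈ convexHull ℝ (H.xPoints K), ‖y - p‖ ≤ C * ε := by
  choose! C hC0 hC using fun v (hv : v ∈ H.verts) => exists_xPoint_vertex hH hv
  obtain ⟨M, hM⟩ := (H.verts_finite.image C).bddAbove
  refine ⟨max M 0, le_max_right _ _, fun K hK ε hε hε1 hKH hHK => ?_⟩
  have hconv : Convex ℝ (convexHull ℝ (H.xPoints K) + Metric.closedBall 0 (max M 0 * ε)) :=
    (convex_convexHull ℝ _).add (convex_closedBall _ _)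
  have hsub : H.verts ⊆ convexHull ℝ (H.xPoints K) + Metric.closedBall 0 (max M 0 * ε) := by
    intro v hv
    obtain ⟨x, hx, hvx⟩ := hC v hv K hK ε hε hε1 hKH hHK
    refine ⟨x, subset_convexHull ℝ _ hx, v - x, ?_, by simp⟩
    rw [mem_closedBall_zero_iff]
    refine hvx.trans (mul_le_mul_of_nonneg_right ?_ hε)
    exact (hM (Set.mem_image_of_mem C hv)).trans (le_max_left _ _)
  intro y hy
  rw [← H.convexHull_verts] at hy
  obtain ⟨p, hp, z, hz, rfl⟩ := convexHull_min hsub hconv hy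
  exact ⟨p, hp, by simpa using hz⟩

end HannerTree

/-! ### Coordinate estimates, the cross-polytope and matrices with small entries. -/

lemma EuclideanSpace.norm_le_sum_abs (x : EucSp n) : ‖x‖ ≤ ∑ i, |x i| := by
  have hx : x = ∑ j, x j • EuclideanSpace.single j (1 : ℝ) := by
    ext k
    simp [Pi.single_apply]
  conv_lhs => rw [hx]
  refine (norm_sum_le _ _).trans (Finset.sum_le_sum fun i _ => ?_)
  simp [norm_smul]

lemma EuclideanSpace.abs_le_norm (x : EucSp n) (i : Fin n) : |x i| ≤ ‖x‖ :=
  PiLp.norm_apply_le x i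

lemma LinearMap.apply_eq_sum_single (f : EucSp n →ₗ[ℝ] ℝ) (x : EucSp n) :
    f x = ∑ j, f (EuclideanSpace.single j 1) * x j := by
  have hx : x = ∑ j, x j • EuclideanSpace.single j (1 : ℝ) := by
    ext k
    simp [Pi.single_apply]
  conv_lhs => rw [hx]
  simp [mul_comm]

lemma closedBall_subset_crossBall : Metric.closedBall 0 (1 / ((n : ℝ) + 1)) ⊆ crossBall n := by
  intro x hx
  rw [mem_closedBall_zero_iff] at hx
  calc ∑ i, |x i| ≤ ∑ _i : Fin n, 1 / ((n : ℝ) + 1) :=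
        Finset.sum_le_sum fun i _ => (EuclideanSpace.abs_le_norm x i).trans hx
    _ = n / ((n : ℝ) + 1) := by simp [div_eq_mul_inv]
    _ ≤ 1 := by rw [div_le_one (by positivity)]; linarith

lemma Convex.crossBall_subset {K : Set (EucSp n)} (hK : Convex ℝ K) (h0 : (0 : EucSp n) ∈ K)
    (h1 : ∀ i, EuclideanSpace.single i (1 : ℝ) ∈ K)
    (h2 : ∀ i, -EuclideanSpace.single i (1 : ℝ) ∈ K) : crossBall n ⊆ K := by
  intro x hx
  have hx : ∑ i, |x i| ≤ 1 := hx
  obtain ⟨z, hz⟩ : ∃ z : Fin n → EucSp n, ∀ i, z i ∈ K ∧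
      |x i| • z i = x i • EuclideanSpace.single i (1 : ℝ) := by
    refine ⟨fun i => if 0 ≤ x i then EuclideanSpace.single i 1 else -EuclideanSpace.single i 1,
      fun i => ?_⟩
    by_cases h : 0 ≤ x i
    · simp only [h, if_true, abs_of_nonneg h]
      exact ⟨h1 i, trivial⟩
    · simp only [h, if_false, abs_of_neg (not_le.1 h), smul_neg, neg_smul, neg_neg]
      exact ⟨h2 i, trivial⟩
  have hxz : x = ∑ i, |x i| • z i := by
    simp only [(hz _).2]
    ext k
    simp [Pi.single_apply]
  have hs0 : 0 ≤ ∑ i, |x i| := Finset.sum_nonneg fun i _ => abs_nonneg _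
  rcases hs0.eq_or_lt with h | h
  · have : x = 0 := by
      rw [← norm_le_zero_iff, h]
      exact EuclideanSpace.norm_le_sum_abs x
    rwa [this]
  · have hm : ∑ i, (|x i| / ∑ j, |x j|) • z i ∈ K := by
      refine hK.sum_mem (fun i _ => by positivity) ?_ fun i _ => (hz i).1
      rw [← Finset.sum_div, div_self h.ne']
    have := hK.smul_mem_of_zero_mem h0 hm ⟨hs0, hx⟩
    rw [Finset.smul_sum] at this
    simp only [smul_smul, mul_div_cancel₀ _ h.ne'] at this
    rwa [hxz]

lemma norm_toEuclideanLin_le {M : Matrix (Fin n) (Fin n) ℝ} {a : ℝ} (hM : ∀ i j, |M i j| ≤ a)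
    (ha : 0 ≤ a) (x : EucSp n) : ‖Matrix.toEuclideanLin M x‖ ≤ n ^ 2 * a * ‖x‖ := by
  refine (EuclideanSpace.norm_le_sum_abs _).trans ?_
  calc ∑ i, |Matrix.toEuclideanLin M x i| ≤ ∑ _i : Fin n, ∑ _j : Fin n, a * ‖x‖ := by
        refine Finset.sum_le_sum fun i _ => ?_
        change |∑ j, M i j * x j| ≤ _
        refine (Finset.abs_sum_le_sum_abs _ _).trans (Finset.sum_le_sum fun j _ => ?_)
        rw [abs_mul]
        exact mul_le_mul (hM i j) (EuclideanSpace.abs_le_norm x j) (abs_nonneg _) ha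
    _ = _ := by simp; ring

/-! ### The linear correction `1 - E`. -/

section Correction

open Classical in
/-- The matrix `E` such that `1 - E` moves `K` into the unit cube and `P` onto the basis vectors,
both up to second order. -/
noncomputable def correction (L : Fin n → Fin n → Prop) (X : Fin n → EucSp n) (f : Fin n → EucSp n →ₗ[ℝ] ℝ) :
    Matrix (Fin n) (Fin n) ℝ :=
  fun i j => if j = i then X i i - 1 else if L i j then X j i
    else -f i (EuclideanSpace.single j 1)

variable {L : Fin n → Fin n → Prop} {X : Fin n → EucSp n} {f : Fin n → EucSp n →ₗ[ℝ] ℝ} {ε : ℝ}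

lemma abs_sub_one_le {t : ℝ} (hε : 0 ≤ ε) (h1 : (1 + ε)⁻¹ ≤ t) (h2 : t ≤ 1 + ε) :
    |t - 1| ≤ ε := by
  have hinv : 1 - ε ≤ (1 + ε)⁻¹ := by
    rw [← one_div, le_div_iff₀ (by linarith)]; nlinarith
  exact abs_le.2 ⟨by linarith, by linarith⟩

lemma abs_correction_le (hε : 0 ≤ ε) (h1 : ∀ i, (1 + ε)⁻¹ ≤ X i i) (h2 : ∀ i, X i i ≤ 1 + ε)
    (hX : ∀ i, ∀ j ≠ i, |X i j| ≤ 2 * ε)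
    (hf : ∀ i, ∀ j ≠ i, |f i (EuclideanSpace.single j 1)| ≤ 2 * ε) (i j : Fin n) :
    |correction L X f i j| ≤ 2 * ε := by
  unfold correction
  split_ifs with h h'
  · have := abs_sub_one_le hε (h1 i) (h2 i)
    linarith
  · exact hX j i (Ne.symm h)
  · rw [abs_neg]; exact hf i j h

/-- The `i`-th coordinate of `x - E x` is compared with `f i x ≤ 1`. The two differ to first order
only through the linked coordinates of `x`, which are either `O(ε)` themselves or force `x i` well
below `1`. -/
lemma correction_apply_le (hε : 0 ≤ ε) (hε1 : ε ≤ 1)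
    (h1 : ∀ i, (1 + ε)⁻¹ ≤ X i i) (h2 : ∀ i, X i i ≤ 1 + ε)
    (hX : ∀ i, ∀ j ≠ i, |X i j| ≤ 2 * ε)
    (hf : ∀ i, ∀ j ≠ i, |f i (EuclideanSpace.single j 1)| ≤ 2 * ε)
    (hfi : ∀ i, f i (EuclideanSpace.single i 1) = (X i i)⁻¹)
    (hfL : ∀ i j, L i j → f i (EuclideanSpace.single j 1) = 0)
    {x : EucSp n} (hx : ∀ i j, L i j → x i + |x j| ≤ 1 + ε) (hx2 : ∀ i, |x i| ≤ 2) {i : Fin n}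
    (hfx : f i x ≤ 1) :
    (x - Matrix.toEuclideanLin (correction L X f) x) i ≤ 1 + n * (6 + 8 * n) * ε ^ 2 := by
  have hM := abs_correction_le (L := L) hε h1 h2 hX hf
  have hMx : Matrix.toEuclideanLin (correction L X f) x i = ∑ j, correction L X f i j * x j := rfl
  rw [PiLp.sub_apply, hMx]
  -- The threshold `(1 + 4n)ε` is chosen for the second case: exceeding it gives `x i ≤ 1 - 4nε`,
  -- and `4nε` bounds `|(E x) i|`.
  by_cases hcase : ∀ j, L i j → |x j| ≤ (1 + 4 * n) * ε
  · have key : x i - ∑ j, correction L X f i j * x j - f i x ≤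
        ∑ _j : Fin n, (6 + 8 * n) * ε ^ 2 := by
      rw [LinearMap.apply_eq_sum_single (f i) x, sub_sub, ← Finset.sum_add_distrib]
      have hxi : x i = ∑ j, if j = i then x j else 0 := by simp
      rw [hxi, ← Finset.sum_sub_distrib]
      refine Finset.sum_le_sum fun j _ => ?_
      unfold correction
      have hn : (0 : ℝ) ≤ n := Nat.cast_nonneg n
      by_cases hji : j = i
      · subst hji
        simp only [if_true, hfi]
        have ht0 : 0 < X j j := lt_of_lt_of_le (by positivity) (h1 j)
        have hth : 1 / 2 ≤ X j j := le_trans (by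
          rw [← one_div]; exact one_div_le_one_div_of_le (by linarith) (by linarith)) (h1 j)
        -- With `t = X j j`, the diagonal entry `1 - (t - 1)` of `1 - E` is the first-order
        -- expansion of `t⁻¹` at `1`, so the difference is quadratic in `t - 1`.
        have e : x j - ((X j j - 1) * x j + (X j j)⁻¹ * x j) =
            (X j j - 1) ^ 2 * ((X j j)⁻¹ * (-x j)) := by
          field_simp
          ring
        have hsq : (X j j - 1) ^ 2 ≤ ε ^ 2 :=
          sq_le_sq' (abs_le.1 (abs_sub_one_le hε (h1 j) (h2 j))).1
            (abs_le.1 (abs_sub_one_le hε (h1 j) (h2 j))).2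
        have hin : (X j j)⁻¹ ≤ 2 := by
          rw [inv_le_comm₀ ht0 two_pos]; linarith
        rw [e]
        calc (X j j - 1) ^ 2 * ((X j j)⁻¹ * (-x j)) ≤ (X j j - 1) ^ 2 * (2 * 2) := by
              refine mul_le_mul_of_nonneg_left ?_ (sq_nonneg _)
              refine (le_abs_self _).trans ?_
              rw [abs_mul, abs_neg, abs_of_pos (inv_pos.2 ht0)]
              exact mul_le_mul hin (hx2 j) (abs_nonneg _) two_pos.le
          _ ≤ ε ^ 2 * (2 * 2) := by gcongr
          _ ≤ (6 + 8 * n) * ε ^ 2 := by nlinarith [sq_nonneg ε]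
      · by_cases hL : L i j
        · simp only [hji, if_false, hL, if_true, hfL i j hL, zero_mul, add_zero, zero_sub]
          refine (neg_le_abs _).trans ?_
          rw [abs_mul]
          calc |X j i| * |x j| ≤ 2 * ε * ((1 + 4 * n) * ε) :=
                mul_le_mul (hX j i (Ne.symm hji)) (hcase j hL) (abs_nonneg _) (by positivity)
            _ ≤ (6 + 8 * n) * ε ^ 2 := by nlinarith [sq_nonneg ε]
        -- For unlinked `j` the entry of `E` is minus the coefficient of `f i`, and the two terms
        -- cancel exactly.
        · simp only [hji, if_false, hL]
          have : (0 : ℝ) ≤ (6 + 8 * n) * ε ^ 2 := by positivity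
          linarith
    simp only [Finset.sum_const, Finset.card_univ, Fintype.card_fin, nsmul_eq_mul] at key
    linarith
  · push Not at hcase
    obtain ⟨k, hk, hkx⟩ := hcase
    have h3 := hx i k hk
    have h4 : |∑ j, correction L X f i j * x j| ≤ ∑ _j : Fin n, 2 * ε * 2 := by
      refine (Finset.abs_sum_le_sum_abs _ _).trans (Finset.sum_le_sum fun j _ => ?_)
      rw [abs_mul]
      exact mul_le_mul (hM i j) (hx2 j) (abs_nonneg _) (by positivity)
    simp only [Finset.sum_const, Finset.card_univ, Fintype.card_fin, nsmul_eq_mul] at h4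
    have h5 := (abs_le.1 h4).1
    have : (0 : ℝ) ≤ n * (6 + 8 * n) * ε ^ 2 := by positivity
    linarith

/-- Since `(1 - E)(1 + E) = 1 - E²`, it suffices to approximate `y = eᵢ + E eᵢ` by a point of `P` to
second order. Symmetry of `L` makes column `i` of `E` agree with `X i - eᵢ` on the diagonal and at
the linked indices, so `y = X i + w` with `w` supported on unlinked indices. -/
lemma exists_correction_near_single (hL : ∀ i j, L i j → L j i) (hε : 0 ≤ ε) (hε1 : ε ≤ 1)
    (hεn : 2 * n * ε ≤ 1)
    (h1 : ∀ i, (1 + ε)⁻¹ ≤ X i i) (h2 : ∀ i, X i i ≤ 1 + ε)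
    (hX : ∀ i, ∀ j ≠ i, |X i j| ≤ 2 * ε)
    (hX0 : ∀ i, ∀ j ≠ i, ¬ L i j → X i j = 0)
    (hf : ∀ i, ∀ j ≠ i, |f i (EuclideanSpace.single j 1)| ≤ 2 * ε)
    {H P : Set (EucSp n)} (hP : Convex ℝ P) {c : ℝ}
    (hHP : ∀ y ∈ H, ∃ p ∈ P, ‖y - p‖ ≤ c * ε) (i : Fin n) (hXP : X i ∈ P)
    (hLi : ¬ L i i)
    (hH : ∀ u ∈ crossBall n, u i = 0 → (∀ j, L i j → u j = 0) →
      EuclideanSpace.single i (1 : ℝ) + u ∈ H) :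
    ∃ p ∈ P, ‖p - Matrix.toEuclideanLin (correction L X f) p - EuclideanSpace.single i (1 : ℝ)‖ ≤
      ((1 + 2 * n ^ 2) * (2 * n * (c + 2 * n)) + (2 * n ^ 2) ^ 2) * ε ^ 2 := by
  classical
  have hM := abs_correction_le (L := L) hε h1 h2 hX hf
  obtain ⟨E, hE⟩ : ∃ E, E = Matrix.toEuclideanLin (correction L X f) := ⟨_, rfl⟩
  have hEn : ∀ x, ‖E x‖ ≤ 2 * n ^ 2 * ε * ‖x‖ := fun x => by
    have := norm_toEuclideanLin_le hM (by positivity) x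
    rw [hE]
    linarith
  obtain ⟨w, hw⟩ : ∃ w : EucSp n, ∀ j, w j =
      if j ≠ i ∧ ¬ L i j then correction L X f j i else 0 := ⟨WithLp.toLp 2 _, fun _ => rfl⟩
  have hwn : ∑ j, |w j| ≤ 2 * n * ε := by
    calc ∑ j, |w j| ≤ ∑ _j : Fin n, 2 * ε := by
          refine Finset.sum_le_sum fun j _ => ?_
          rw [hw]
          split_ifs
          · exact hM j i
          · rw [abs_zero]; positivity
      _ = 2 * n * ε := by simp; ring
  -- The number `2nε` bounds the `ℓ₁`-norm of `w`, so `u = τ⁻¹ w` lies in the cross-polytope and `eᵢ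
  -- + u ∈ H` has a point `z` of `P` within `cε`.
  obtain ⟨τ, hτ⟩ : ∃ τ, τ = 2 * n * ε := ⟨_, rfl⟩
  have hτ0 : 0 ≤ τ := by rw [hτ]; positivity
  rw [← hτ] at hεn hwn
  have hu : τ • (τ⁻¹ • w) = w := by
    rcases hτ0.eq_or_lt with h | h
    · have : w = 0 := by
        rw [← norm_le_zero_iff, h]
        exact (EuclideanSpace.norm_le_sum_abs w).trans hwn
      simp [this]
    · rw [smul_smul, mul_inv_cancel₀ h.ne', one_smul]
  have huc : τ⁻¹ • w ∈ crossBall n := by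
    change ∑ j, |(τ⁻¹ • w) j| ≤ 1
    simp only [PiLp.smul_apply, smul_eq_mul, abs_mul, ← Finset.mul_sum,
      abs_of_nonneg (inv_nonneg.2 hτ0)]
    exact (mul_le_mul_of_nonneg_left hwn (inv_nonneg.2 hτ0)).trans inv_mul_le_one
  obtain ⟨z, hzP, hz⟩ := hHP _ (hH _ huc (by simp [hw]) fun j hj => by simp [hw, hj])
  obtain ⟨y, hy⟩ : ∃ y, y = X i + w := ⟨_, rfl⟩
  have hyE : y = EuclideanSpace.single i 1 + E (EuclideanSpace.single i 1) := by
    rw [hy]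
    ext j
    have hEj : E (EuclideanSpace.single i 1) j = correction L X f j i := by
      rw [hE]
      change ∑ k, correction L X f j k * EuclideanSpace.single i (1 : ℝ) k = _
      simp
    rw [PiLp.add_apply, PiLp.add_apply, hEj, hw]
    unfold correction
    by_cases hji : j = i
    · subst hji
      simp
    · by_cases hl : L i j
      · simp [hji, Ne.symm hji, hl, hL i j hl]
      · have hl' : ¬ L j i := fun h => hl (hL _ _ h)
        simp [hji, Ne.symm hji, hl, hl', hX0 i j hji hl]
  have hXe : ‖EuclideanSpace.single i (1 : ℝ) - X i‖ ≤ 2 * n * ε := by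
    refine (EuclideanSpace.norm_le_sum_abs _).trans ?_
    calc ∑ j, |(EuclideanSpace.single i (1 : ℝ) - X i) j| ≤ ∑ _j : Fin n, 2 * ε := by
          refine Finset.sum_le_sum fun j _ => ?_
          by_cases hji : j = i
          · subst hji
            have := abs_sub_one_le hε (h1 j) (h2 j)
            rw [abs_sub_comm] at this
            simp only [PiLp.sub_apply, PiLp.single_apply, if_true]
            linarith
          · simpa [hji] using hX i j hji
      _ = 2 * n * ε := by simp; ring
  -- Moving from `X i` towards `z` by the fraction `τ` displaces it by `τ(z - X i)`, which differs
  -- from `w = τ u` by `τ` times an `O(ε)` error.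
  refine ⟨(1 - τ) • X i + τ • z, hP hXP hzP (by linarith) hτ0 (by ring), ?_⟩
  obtain ⟨p, hp⟩ : ∃ p, p = (1 - τ) • X i + τ • z := ⟨_, rfl⟩
  rw [← hp, ← hE]
  have hpy : ‖p - y‖ ≤ 2 * n * (c + 2 * n) * ε ^ 2 := by
    have e : p - y = τ • (-(EuclideanSpace.single i (1 : ℝ) + τ⁻¹ • w - z) +
        (EuclideanSpace.single i (1 : ℝ) - X i)) := by
      have : τ • (-(EuclideanSpace.single i (1 : ℝ) + τ⁻¹ • w - z) +
        (EuclideanSpace.single i (1 : ℝ) - X i)) = τ • (z - X i) - τ • (τ⁻¹ • w) := by module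
      rw [this, hu, hp, hy]
      module
    rw [e, norm_smul, Real.norm_of_nonneg hτ0]
    calc τ * ‖-(EuclideanSpace.single i (1 : ℝ) + τ⁻¹ • w - z) +
          (EuclideanSpace.single i (1 : ℝ) - X i)‖ ≤ τ * (c * ε + 2 * n * ε) := by
          refine mul_le_mul_of_nonneg_left ((norm_add_le _ _).trans ?_) hτ0
          rw [norm_neg]
          exact add_le_add hz hXe
      _ = _ := by rw [hτ]; ring
  have e : p - E p - EuclideanSpace.single i (1 : ℝ) =
      (p - y) - E (p - y) - E (E (EuclideanSpace.single i 1)) := by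
    have h3 : E y = E (EuclideanSpace.single i 1) + E (E (EuclideanSpace.single i 1)) := by
      rw [hyE, map_add]
    have h4 : E (EuclideanSpace.single i 1) = y - EuclideanSpace.single i 1 := by
      rw [hyE]; abel
    rw [map_sub, h3]
    nth_rewrite 1 [h4]
    abel
  rw [e]
  have a1 : ‖E (E (EuclideanSpace.single i (1 : ℝ)))‖ ≤ (2 * n ^ 2) ^ 2 * ε ^ 2 := by
    refine (hEn _).trans ?_
    have := hEn (EuclideanSpace.single i (1 : ℝ))
    rw [PiLp.norm_single, norm_one, mul_one] at this
    calc 2 * n ^ 2 * ε * ‖E (EuclideanSpace.single i (1 : ℝ))‖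
        ≤ 2 * n ^ 2 * ε * (2 * n ^ 2 * ε) := by gcongr
      _ = _ := by ring
  have a2 : ‖E (p - y)‖ ≤ 2 * n ^ 2 * ‖p - y‖ := by
    refine (hEn _).trans ?_
    have : 2 * (n : ℝ) ^ 2 * ε ≤ 2 * n ^ 2 * 1 := by gcongr
    rw [mul_one] at this
    gcongr
  calc ‖(p - y) - E (p - y) - E (E (EuclideanSpace.single i 1))‖
      ≤ ‖p - y‖ + ‖E (p - y)‖ + ‖E (E (EuclideanSpace.single i (1 : ℝ)))‖ :=
        (norm_sub_le _ _).trans (add_le_add_left (norm_sub_le _ _) _)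
    _ ≤ (1 + 2 * n ^ 2) * ‖p - y‖ + (2 * n ^ 2) ^ 2 * ε ^ 2 := by linarith
    _ ≤ (1 + 2 * n ^ 2) * (2 * n * (c + 2 * n) * ε ^ 2) + (2 * n ^ 2) ^ 2 * ε ^ 2 := by gcongr
    _ = _ := by ring

end Correction

/-! ### Construction of `K` from the corrected polytope. -/

lemma convex_cubeBall : Convex ℝ (cubeBall n) := by
  intro x hx y hy a b ha hb hab i
  simp only [PiLp.add_apply, PiLp.smul_apply, smul_eq_mul]
  calc |a * x i + b * y i| ≤ a * |x i| + b * |y i| := by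
        refine (abs_add_le _ _).trans_eq ?_
        rw [abs_mul, abs_mul, abs_of_nonneg ha, abs_of_nonneg hb]
    _ ≤ a * 1 + b * 1 :=
        add_le_add (mul_le_mul_of_nonneg_left (hx i) ha) (mul_le_mul_of_nonneg_left (hy i) hb)
    _ = 1 := by linarith

lemma Convex.forall_exists_norm_sub_le {E : Type*} [NormedAddCommGroup E] [NormedSpace ℝ E]
    {s H : Set E} (hH : Convex ℝ H) {r : ℝ} (h : ∀ x ∈ s, ∃ y ∈ H, ‖x - y‖ ≤ r) :
    ∀ x ∈ convexHull ℝ s, ∃ y ∈ H, ‖x - y‖ ≤ r := by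
  have hsub : s ⊆ H + Metric.closedBall 0 r := by
    intro x hx
    obtain ⟨y, hy, hxy⟩ := h x hx
    exact ⟨y, hy, x - y, by rwa [mem_closedBall_zero_iff], by simp⟩
  intro x hx
  obtain ⟨y, hy, z, hz, rfl⟩ := convexHull_min hsub (hH.add (convex_closedBall _ _)) hx
  exact ⟨y, hy, by simpa using hz⟩

/-- A symmetric polytope `K` between the cross-polytope and the cube is obtained from `λ⁻¹ S P` by
adding the vectors `± eᵢ`, if `S` maps `P` into the cube and close to the vectors `eᵢ`, up to the
factor `λ = 1 + η`. -/
lemma exists_polytope_between {X H : Set (EucSp n)} (hX : X.Finite) (hXn : -X = X)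
    (S : EucSp n ≃ₗ[ℝ] EucSp n) {η : ℝ} (hη : 0 ≤ η) (hη1 : η ≤ 1)
    (hcube : ∀ x ∈ X, ∀ i, S x i ≤ 1 + η)
    (hsingle : ∀ i, (1 + η)⁻¹ • EuclideanSpace.single i (1 : ℝ) ∈ S '' convexHull ℝ X)
    (h0 : (0 : EucSp n) ∈ convexHull ℝ X)
    (hH : Convex ℝ H) (heH : ∀ i, EuclideanSpace.single i (1 : ℝ) ∈ H)
    (heH' : ∀ i, -EuclideanSpace.single i (1 : ℝ) ∈ H) {r : ℝ} (hr : 0 ≤ r)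
    (hSH : ∀ x ∈ X, ∃ y ∈ H, ‖(1 + η)⁻¹ • S x - y‖ ≤ r)
    (hHS : ∀ y ∈ H, ∃ x ∈ convexHull ℝ X, ‖y - (1 + η)⁻¹ • S x‖ ≤ r) :
    ∃ K : Set (EucSp n), IsPolytope K ∧ IsSymmConvexBody K ∧
      |bmDist K (convexHull ℝ X) - 1| ≤ 3 * η ∧ Metric.hausdorffDist K H ≤ r ∧
      crossBall n ⊆ K ∧ K ⊆ cubeBall n := by
  obtain ⟨l, hl⟩ : ∃ l, l = 1 + η := ⟨_, rfl⟩
  simp only [← hl] at hcube hsingle hSH hHS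
  have hl1 : 1 ≤ l := by linarith
  have hl0 : 0 < l := by linarith
  have hli1 : l⁻¹ ≤ 1 := inv_le_one_of_one_le₀ hl1
  obtain ⟨D, hD⟩ : ∃ D : Set (EucSp n), D =
      Set.range (fun i => EuclideanSpace.single i (1 : ℝ)) ∪
        Set.range (fun i => -EuclideanSpace.single i (1 : ℝ)) := ⟨_, rfl⟩
  obtain ⟨Q, hQ⟩ : ∃ Q : Set (EucSp n), Q = (fun x => l⁻¹ • S x) '' X ∪ D := ⟨_, rfl⟩
  have hDfin : D.Finite := by rw [hD]; exact (Set.finite_range _).union (Set.finite_range _)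
  have hQfin : Q.Finite := by rw [hQ]; exact (hX.image _).union hDfin
  have hXm : ∀ x ∈ X, -x ∈ X := fun x hx => by rw [← hXn]; simpa using hx
  have hDm : ∀ x ∈ D, -x ∈ D := by
    rw [hD]
    rintro _ (⟨i, rfl⟩ | ⟨i, rfl⟩)
    · exact Or.inr ⟨i, rfl⟩
    · exact Or.inl ⟨i, by simp⟩
  have hQm : ∀ x ∈ Q, -x ∈ Q := by
    rw [hQ]
    rintro _ (⟨x, hx, rfl⟩ | hx)
    · exact Or.inl ⟨-x, hXm x hx, by simp⟩
    · exact Or.inr (hDm _ hx)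
  have hQn : -Q = Q := by
    ext x
    exact ⟨fun h => by simpa using hQm _ h, fun h => hQm x h⟩
  have hSconv : ∀ x ∈ convexHull ℝ X, l⁻¹ • S x ∈ convexHull ℝ Q := by
    intro x hx
    have : (l⁻¹ • S.toLinearMap) '' convexHull ℝ X ⊆ convexHull ℝ Q := by
      rw [LinearMap.image_convexHull]
      refine convexHull_mono ?_
      rw [hQ]
      exact Set.subset_union_left
    exact this ⟨x, hx, rfl⟩
  have hKcube : convexHull ℝ Q ⊆ cubeBall n := by
    refine convexHull_min ?_ convex_cubeBall
    rw [hQ, hD]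
    rintro _ (⟨x, hx, rfl⟩ | ⟨i, rfl⟩ | ⟨i, rfl⟩)
    · intro i
      -- The one-sided bound is used at `x` and at `-x`.
      have h1 := hcube x hx i
      have h2 := hcube (-x) (hXm x hx) i
      rw [map_neg, PiLp.neg_apply] at h2
      simp only [PiLp.smul_apply, smul_eq_mul, abs_mul, abs_of_pos (inv_pos.2 hl0)]
      rw [inv_mul_le_iff₀ hl0, mul_one, abs_le]
      exact ⟨by linarith, h1⟩
    · intro j
      by_cases h : j = i
      · subst h; simp
      · simp [h]
    · intro j
      by_cases h : j = i
      · subst h; simp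
      · simp [h]
  have hDK : D ⊆ convexHull ℝ Q := by
    rw [hQ]; exact Set.subset_union_right.trans (subset_convexHull ℝ _)
  have h0K : (0 : EucSp n) ∈ convexHull ℝ Q := by simpa using hSconv 0 h0
  have hcross : crossBall n ⊆ convexHull ℝ Q := by
    refine (convex_convexHull ℝ Q).crossBall_subset h0K (fun i => hDK ?_) fun i => hDK ?_
    · rw [hD]; exact Or.inl ⟨i, rfl⟩
    · rw [hD]; exact Or.inr ⟨i, rfl⟩
  have hXhm : ∀ x ∈ convexHull ℝ X, -x ∈ convexHull ℝ X := fun x hx => by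
    rw [← hXn, convexHull_neg]; simpa using hx
  have hKS : ∀ k ∈ convexHull ℝ Q, ∃ x ∈ convexHull ℝ X, k = l • S x := by
    have hsub : Q ⊆ (l • S.toLinearMap) '' convexHull ℝ X := by
      have hgen : ∀ i, ∃ x ∈ convexHull ℝ X, (l • S.toLinearMap) x =
          EuclideanSpace.single i (1 : ℝ) := fun i => by
        obtain ⟨x, hx, hxe⟩ := hsingle i
        refine ⟨x, hx, ?_⟩
        simp only [LinearMap.smul_apply, LinearEquiv.coe_coe, hxe, smul_smul,
          mul_inv_cancel₀ hl0.ne', one_smul]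
      rw [hQ, hD]
      rintro _ (⟨x, hx, rfl⟩ | ⟨i, rfl⟩ | ⟨i, rfl⟩)
      -- Here `l⁻¹ S x = l S (l⁻² x)`, and `l⁻² x` stays in the hull since the hull contains the
      -- origin.
      · refine ⟨(l⁻¹ * l⁻¹) • x, (convex_convexHull ℝ X).smul_mem_of_zero_mem h0
          (subset_convexHull ℝ _ hx) ⟨by positivity, by nlinarith [inv_pos.2 hl0]⟩, ?_⟩
        simp only [LinearMap.smul_apply, LinearEquiv.coe_coe, map_smul, smul_smul]
        rw [mul_assoc, inv_mul_cancel₀ hl0.ne', mul_one]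
      · exact hgen i
      · obtain ⟨x, hx, hxe⟩ := hgen i
        exact ⟨-x, hXhm x hx, by rw [map_neg, hxe]⟩
    intro k hk
    obtain ⟨x, hx, rfl⟩ := convexHull_min hsub
      ((convex_convexHull ℝ X).linear_image (l • S.toLinearMap)) hk
    exact ⟨x, hx, rfl⟩
  have hne : (0 : ℝ) < 1 / ((n : ℝ) + 1) := by positivity
  refine ⟨convexHull ℝ Q, ⟨hQfin.toFinset, by simp⟩,
    ⟨convex_convexHull ℝ _, hQfin.isCompact_convexHull ℝ, ⟨0, ?_⟩, ?_⟩, ?_, ?_, hcross, hKcube⟩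
  · exact interior_mono (closedBall_subset_crossBall.trans hcross)
      (Metric.ball_subset_interior_closedBall (Metric.mem_ball_self hne))
  · rw [← convexHull_neg, hQn]
  -- The map `T = l S⁻¹` realises the sandwich `l⁻¹ S P ⊆ K ⊆ l S P`, and `l² - 1 = 2η + η² ≤ 3η`.
  · have hmem : l * l ∈ {c : ℝ | 1 ≤ c ∧ ∃ T : EucSp n ≃ₗ[ℝ] EucSp n,
        convexHull ℝ X ⊆ T '' convexHull ℝ Q ∧ T '' convexHull ℝ Q ⊆ c • convexHull ℝ X} := by
      refine ⟨by nlinarith, S.symm.trans (LinearEquiv.smulOfNeZero ℝ _ l hl0.ne'), ?_, ?_⟩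
      · intro x hx
        refine ⟨_, hSconv x hx, ?_⟩
        simp [smul_smul, inv_mul_cancel₀ hl0.ne']
      · rintro _ ⟨k, hk, rfl⟩
        obtain ⟨x, hx, rfl⟩ := hKS k hk
        refine ⟨x, hx, ?_⟩
        simp [smul_smul]
    have hle : bmDist (convexHull ℝ Q) (convexHull ℝ X) ≤ l * l :=
      csInf_le ⟨1, fun c hc => hc.1⟩ hmem
    have hge : 1 ≤ bmDist (convexHull ℝ Q) (convexHull ℝ X) :=
      le_csInf ⟨_, hmem⟩ fun c hc => hc.1
    rw [abs_of_nonneg (by linarith)]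
    rw [hl] at hle
    nlinarith
  · refine Metric.hausdorffDist_le_of_mem_dist hr ?_ ?_
    · simp only [dist_eq_norm]
      refine hH.forall_exists_norm_sub_le ?_
      rw [hQ, hD]
      rintro _ (⟨x, hx, rfl⟩ | ⟨i, rfl⟩ | ⟨i, rfl⟩)
      · exact hSH x hx
      · exact ⟨_, heH i, by simpa using hr⟩
      · exact ⟨_, heH' i, by simpa using hr⟩
    · intro y hy
      obtain ⟨x, hx, hxy⟩ := hHS y hy
      exact ⟨_, hSconv x hx, by rwa [dist_eq_norm]⟩

/-- The quantitative construction of `K` from a nearly identical linear map `S`. -/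
lemma exists_polytope_of_near_id {n : ℕ} {ρ R κ A B c : ℝ} (hρ : 0 < ρ) (hR : 0 ≤ R) (hκ : 0 ≤ κ)
    (hA : 0 ≤ A) (hB : 0 ≤ B) (hc : 0 ≤ c) :
    ∃ C : ℝ, 0 < C ∧ ∃ ε₀ : ℝ, 0 < ε₀ ∧ ∀ (X H : Set (EucSp n)) (S : EucSp n →ₗ[ℝ] EucSp n)
      (ε : ℝ), 0 ≤ ε → ε ≤ ε₀ → X.Finite → -X = X → Convex ℝ H →
      Metric.closedBall 0 (2 * ρ) ⊆ H → (∀ x ∈ H, ‖x‖ ≤ R) →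
      (∀ i, EuclideanSpace.single i (1 : ℝ) ∈ H) → (∀ i, -EuclideanSpace.single i (1 : ℝ) ∈ H) →
      (∀ x ∈ X, (1 + ε)⁻¹ • x ∈ H) → (∀ y ∈ H, ∃ p ∈ convexHull ℝ X, ‖y - p‖ ≤ c * ε) →
      (∀ x, ‖S x - x‖ ≤ κ * ε * ‖x‖) → (∀ x ∈ X, ∀ i, S x i ≤ 1 + A * ε ^ 2) →
      (∀ i, ∃ p ∈ convexHull ℝ X, ‖S p - EuclideanSpace.single i (1 : ℝ)‖ ≤ B * ε ^ 2) →
      ∃ K : Set (EucSp n), IsPolytope K ∧ IsSymmConvexBody K ∧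
        |bmDist K (convexHull ℝ X) - 1| ≤ C * ε ^ 2 ∧ Metric.hausdorffDist K H ≤ C * ε ∧
        crossBall n ⊆ K ∧ K ⊆ cubeBall n := by
  -- The dilation excess will be `η = D ε²`. The term `A` absorbs the overshoot of the cube; `2B /
  -- ρ` absorbs the `B ε²` error at `eᵢ`, measured against a ball of radius `ρ / 2` in the image of
  -- the hull.
  obtain ⟨D, hD⟩ : ∃ D, D = A + 2 * B / ρ := ⟨_, rfl⟩
  have hD0 : 0 ≤ D := by rw [hD]; positivity
  -- The summands bound the distance from `H` to the hull, the dilation by `(1 + η)⁻¹`, the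
  -- displacement by `S`, and the shrinking of `X` into `H`.
  obtain ⟨r₀, hr₀⟩ : ∃ r₀, r₀ = c + 4 * R * D + 2 * R * κ + 2 * R := ⟨_, rfl⟩
  have hr₀0 : 0 ≤ r₀ := by rw [hr₀]; positivity
  obtain ⟨ε₀, hε₀0, hε₀1, hε₀κ, hε₀c, hε₀D⟩ : ∃ ε₀ : ℝ, 0 < ε₀ ∧ ε₀ ≤ 1 ∧ κ * ε₀ ≤ 1 / 2 ∧
      c * ε₀ ≤ ρ ∧ D * ε₀ ≤ 1 := by
    have hm : 0 < 1 + 2 * κ + c / ρ + D := by positivity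
    have key : ∀ a b : ℝ, 0 < b → a ≤ b * (1 + 2 * κ + c / ρ + D) →
        a * (1 + 2 * κ + c / ρ + D)⁻¹ ≤ b := fun a b hb hab => by
      rwa [← div_eq_mul_inv, div_le_iff₀ hm]
    have hcρ : 0 ≤ c / ρ := by positivity
    refine ⟨(1 + 2 * κ + c / ρ + D)⁻¹, inv_pos.2 hm, inv_le_one_of_one_le₀ (by linarith),
      key _ _ (by norm_num) (by linarith), key _ _ hρ ?_, key _ _ one_pos (by linarith)⟩
    have : c = ρ * (c / ρ) := by field_simp
    nlinarith [mul_nonneg hρ.le hκ, mul_nonneg hρ.le hD0]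
  refine ⟨3 * D + r₀ + 1, by positivity, ε₀, hε₀0, ?_⟩
  intro X H S ε hε hεε₀ hX hXn hH hball hHR heH heH' hXH hHX hS hcube hsingle
  have hε1 : ε ≤ 1 := hεε₀.trans hε₀1
  have hεκ : κ * ε ≤ 1 / 2 := (mul_le_mul_of_nonneg_left hεε₀ hκ).trans hε₀κ
  have hεc : c * ε ≤ ρ := (mul_le_mul_of_nonneg_left hεε₀ hc).trans hε₀c
  have hεD : D * ε ≤ 1 := (mul_le_mul_of_nonneg_left hεε₀ hD0).trans hε₀D
  have hcompact := hX.isCompact_convexHull ℝ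
  have hballX : Metric.closedBall 0 ρ ⊆ convexHull ℝ X := by
    refine (convex_convexHull ℝ X).closedBall_subset_of_forall_dist_le hcompact.isClosed hρ.le
      (s := c * ε) (by positivity) fun x hx => hHX x (hball ?_)
    rw [mem_closedBall_zero_iff]
    linarith
  have hSlow : ∀ x, ‖x‖ ≤ 2 * ‖S x‖ := fun x => by
    have h1 := hS x
    have h2 : κ * ε * ‖x‖ ≤ 1 / 2 * ‖x‖ := by gcongr
    have h3 := norm_le_norm_add_norm_sub (S x) x
    linarith
  have hSup : ∀ x, ‖S x‖ ≤ 2 * ‖x‖ := fun x => by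
    have h1 := hS x
    have h2 : κ * ε * ‖x‖ ≤ 1 / 2 * ‖x‖ := by gcongr
    have h3 := norm_le_norm_add_norm_sub x (S x)
    rw [norm_sub_rev] at h3
    linarith [norm_nonneg x]
  have hinj : Function.Injective S := by
    rw [injective_iff_map_eq_zero]
    intro x hx
    have := hSlow x
    rw [hx, norm_zero, mul_zero] at this
    exact norm_le_zero_iff.1 this
  obtain ⟨T, hT⟩ : ∃ T : EucSp n ≃ₗ[ℝ] EucSp n, ∀ x, T x = S x :=
    ⟨LinearEquiv.ofInjectiveEndo S hinj, fun _ => rfl⟩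
  -- `S` shrinks norms at most by the factor `2`, so the image of the ball of radius `ρ` contains
  -- the ball of radius `ρ / 2`.
  have hballS : Metric.closedBall 0 (ρ / 2) ⊆ T '' convexHull ℝ X := by
    intro y hy
    rw [mem_closedBall_zero_iff] at hy
    refine ⟨T.symm y, hballX ?_, by simp⟩
    rw [mem_closedBall_zero_iff]
    have := hSlow (T.symm y)
    rw [← hT, T.apply_symm_apply] at this
    linarith
  obtain ⟨η, hη⟩ : ∃ η, η = D * ε ^ 2 := ⟨_, rfl⟩
  have hη0 : 0 ≤ η := by rw [hη]; positivity
  have hηε : η ≤ D * ε := by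
    have : D * ε * ε ≤ D * ε * 1 := by gcongr
    rw [hη]; linarith
  have hXnorm : ∀ x ∈ X, ‖x‖ ≤ 2 * R := fun x hx => by
    have := hHR _ (hXH x hx)
    rw [norm_smul, Real.norm_of_nonneg (by positivity), inv_mul_le_iff₀ (by linarith)] at this
    nlinarith
  have hXhnorm : ∀ x ∈ convexHull ℝ X, ‖x‖ ≤ 2 * R := fun x hx => by
    have : convexHull ℝ X ⊆ Metric.closedBall 0 (2 * R) :=
      convexHull_min (fun x hx => by simpa using hXnorm x hx) (convex_closedBall _ _)
    simpa using this hx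
  have hinv : 1 - η ≤ (1 + η)⁻¹ := by
    rw [← one_div, le_div_iff₀ (by linarith)]; nlinarith
  have hinv1 : (1 + η)⁻¹ ≤ 1 := inv_le_one_of_one_le₀ (by linarith)
  have hdil : ∀ x, ‖x‖ ≤ 2 * R → ‖(1 + η)⁻¹ • T x - x‖ ≤ (4 * R * D + 2 * R * κ) * ε := by
    intro x hx
    have e : (1 + η)⁻¹ • T x - x = ((1 + η)⁻¹ - 1) • T x + (S x - x) := by
      rw [← hT x]; module
    rw [e]
    calc ‖((1 + η)⁻¹ - 1) • T x + (S x - x)‖ ≤ D * ε * (2 * (2 * R)) + κ * ε * (2 * R) := by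
          refine (norm_add_le _ _).trans (add_le_add ?_ ((hS x).trans (by gcongr)))
          rw [norm_smul, Real.norm_eq_abs, abs_of_nonpos (by linarith), hT]
          refine mul_le_mul (by linarith) ((hSup x).trans (by linarith)) (norm_nonneg _)
            (by positivity)
      _ = _ := by ring
  have hr : 0 ≤ r₀ * ε := by positivity
  have a1 : ∀ x ∈ X, ∀ i, T x i ≤ 1 + η := by
    intro x hx i
    rw [hT]
    refine (hcube x hx i).trans ?_
    have : 0 ≤ 2 * B / ρ * ε ^ 2 := by positivity
    rw [hη, hD]
    linarith
  have a2 : ∀ i, (1 + η)⁻¹ • EuclideanSpace.single i (1 : ℝ) ∈ T '' convexHull ℝ X := by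
    intro i
    obtain ⟨p, hp, hpe⟩ := hsingle i
    have hconv : Convex ℝ (T '' convexHull ℝ X) :=
      (convex_convexHull ℝ X).linear_image T.toLinearMap
    have hz : ‖EuclideanSpace.single i (1 : ℝ) - T p‖ ≤ η * (ρ / 2) := by
      rw [norm_sub_rev, hT]
      refine hpe.trans ?_
      have e : η * (ρ / 2) = A * ρ / 2 * ε ^ 2 + B * ε ^ 2 := by
        rw [hη, hD]; field_simp
      rw [e]
      have : 0 ≤ A * ρ / 2 * ε ^ 2 := by positivity
      linarith
    have := hconv.inv_smul_add_mem hballS ⟨p, hp, rfl⟩ hη0 hz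
    rwa [add_sub_cancel] at this
  have a3 : ∀ x ∈ X, ∃ y ∈ H, ‖(1 + η)⁻¹ • T x - y‖ ≤ r₀ * ε := by
    intro x hx
    refine ⟨_, hXH x hx, ?_⟩
    have e : (1 + η)⁻¹ • T x - (1 + ε)⁻¹ • x =
        ((1 + η)⁻¹ • T x - x) + (1 - (1 + ε)⁻¹) • x := by module
    have hinvε : 1 - ε ≤ (1 + ε)⁻¹ := by
      rw [← one_div, le_div_iff₀ (by linarith)]; nlinarith
    have hinvε1 : (1 + ε)⁻¹ ≤ 1 := inv_le_one_of_one_le₀ (by linarith)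
    rw [e]
    calc _ ≤ (4 * R * D + 2 * R * κ) * ε + ε * (2 * R) := by
          refine (norm_add_le _ _).trans (add_le_add (hdil x (hXnorm x hx)) ?_)
          rw [norm_smul, Real.norm_of_nonneg (by linarith)]
          exact mul_le_mul (by linarith) (hXnorm x hx) (norm_nonneg _) hε
      _ ≤ r₀ * ε := by
          have : 0 ≤ c * ε := by positivity
          rw [hr₀]; linarith
  have a4 : ∀ y ∈ H, ∃ x ∈ convexHull ℝ X, ‖y - (1 + η)⁻¹ • T x‖ ≤ r₀ * ε := by
    intro y hy
    obtain ⟨p, hp, hyp⟩ := hHX y hy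
    refine ⟨p, hp, ?_⟩
    have e : y - (1 + η)⁻¹ • T p = (y - p) - ((1 + η)⁻¹ • T p - p) := by abel
    rw [e]
    calc _ ≤ c * ε + (4 * R * D + 2 * R * κ) * ε :=
          (norm_sub_le _ _).trans (add_le_add hyp (hdil p (hXhnorm p hp)))
      _ ≤ r₀ * ε := by
          have : 0 ≤ 2 * R * ε := by positivity
          rw [hr₀]; linarith
  obtain ⟨K, h1, h2, h3, h4, h5, h6⟩ := exists_polytope_between hX hXn T hη0
    (hηε.trans hεD) a1 a2 (hballX (by simpa using hρ.le)) hH heH heH' hr a3 a4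
  refine ⟨K, h1, h2, h3.trans ?_, h4.trans ?_, h5, h6⟩
  · rw [hη]
    nlinarith [mul_nonneg hr₀0 (sq_nonneg ε), sq_nonneg ε]
  · have : (0 : ℝ) ≤ 3 * D * ε := by positivity
    linarith

/-! ### Finiteness of the representations and assembly of the proof. -/

namespace HannerTree

lemma leaves_ne_nil (H : HannerTree n) : H.leaves ≠ [] := by
  induction H with
  | interval i => simp [leaves]
  | sumOne H₁ H₂ ih₁ ih₂ => simp [leaves, ih₁]
  | sumInf H₁ H₂ ih₁ ih₂ => simp [leaves, ih₁]

/-- Both summands of a sum have at least one leaf, hence strictly fewer leaves than the sum. A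
standard representation has at most `n` leaves, which yields constants depending only on `n`. -/
lemma finite_length_le (m : ℕ) : {H : HannerTree n | H.leaves.length ≤ m}.Finite := by
  induction m with
  | zero =>
    refine Set.Finite.subset Set.finite_empty fun H hH => H.leaves_ne_nil ?_
    exact List.length_eq_zero_iff.1 (Nat.le_zero.1 hH)
  | succ m ih =>
    refine ((Set.finite_range interval).union
      ((ih.image2 sumOne ih).union (ih.image2 sumInf ih))).subset fun H hH => ?_
    have key : ∀ H₁ H₂ : HannerTree n, (H₁.leaves ++ H₂.leaves).length ≤ m + 1 →
        H₁.leaves.length ≤ m ∧ H₂.leaves.length ≤ m := by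
      intro H₁ H₂ h
      have h1 := List.length_pos_iff.2 H₁.leaves_ne_nil
      have h2 := List.length_pos_iff.2 H₂.leaves_ne_nil
      rw [List.length_append] at h
      omega
    cases H with
    | interval i => exact Or.inl ⟨i, rfl⟩
    | sumOne H₁ H₂ =>
      exact Or.inr (Or.inl ⟨H₁, (key H₁ H₂ hH).1, H₂, (key H₁ H₂ hH).2, rfl⟩)
    | sumInf H₁ H₂ =>
      exact Or.inr (Or.inr ⟨H₁, (key H₁ H₂ hH).1, H₂, (key H₁ H₂ hH).2, rfl⟩)

lemma finite_isStandard : {H : HannerTree n | H.IsStandard}.Finite :=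
  (finite_length_le n).subset fun H hH => by
    simpa using hH.1.length_le_card

lemma crossBall_subset_body {H : HannerTree n} (hH : H.IsStandard) : crossBall n ⊆ H.body :=
  H.convex_body.crossBall_subset H.zero_mem_body (fun i => single_mem_body (hH.2 i))
    fun i => neg_mem_body (single_mem_body (hH.2 i))

lemma exists_polytope_near {H : HannerTree n} (hH : H.IsStandard) :
    ∃ C : ℝ, 0 < C ∧ ∃ δ₀ : ℝ, 0 < δ₀ ∧ ∀ K₀ : Set (EucSp n), IsSymmConvexBody K₀ →
      Metric.hausdorffDist K₀ H.body < δ₀ →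
        ∃ K : Set (EucSp n), IsPolytope K ∧ IsSymmConvexBody K ∧
          |bmDist K (xPointHull H K₀) - 1| ≤ C * Metric.hausdorffDist K₀ H.body ^ 2 ∧
          Metric.hausdorffDist K H.body ≤ C * Metric.hausdorffDist K₀ H.body ∧
          crossBall n ⊆ K ∧ K ⊆ cubeBall n := by
  -- `H` contains the cross-polytope and hence the ball of radius `2ρ`; one half of this radius is
  -- kept in reserve, so that `K₀` contains the ball of radius `ρ` as soon as `δ ≤ ρ`.
  obtain ⟨ρ, hρ⟩ : ∃ ρ, ρ = 1 / ((n : ℝ) + 1) / 2 := ⟨_, rfl⟩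
  have hρ0 : 0 < ρ := by rw [hρ]; positivity
  have hball : Metric.closedBall 0 (2 * ρ) ⊆ H.body := by
    rw [show 2 * ρ = 1 / ((n : ℝ) + 1) by rw [hρ]; ring]
    exact closedBall_subset_crossBall.trans (crossBall_subset_body hH)
  have hballρ : Metric.closedBall 0 ρ ⊆ H.body :=
    (Metric.closedBall_subset_closedBall (by linarith)).trans hball
  obtain ⟨R, hR⟩ := H.isCompact_body.isBounded.exists_norm_le
  have hR0 : 0 ≤ R := (norm_nonneg _).trans (hR 0 H.zero_mem_body)
  obtain ⟨c, hc, hnear⟩ := exists_near_xPointHull hH.1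
  obtain ⟨C, hC, ε₀, hε₀, main⟩ := exists_polytope_of_near_id (n := n) (ρ := ρ) (R := R)
    (κ := 2 * n ^ 2) (A := n * (6 + 8 * n))
    (B := (1 + 2 * n ^ 2) * (2 * n * (c + 2 * n)) + (2 * n ^ 2) ^ 2) (c := c)
    hρ0 hR0 (by positivity) (by positivity) (by positivity) hc
  obtain ⟨ε₁, hε₁0, hε₁, hε₁1, hε₁n⟩ : ∃ ε₁ : ℝ, 0 < ε₁ ∧ ε₁ ≤ ε₀ ∧ ε₁ ≤ 1 ∧ 2 * n * ε₁ ≤ 1 := by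
    refine ⟨min ε₀ (1 / (2 * n + 1)), by positivity, min_le_left _ _,
      (min_le_right _ _).trans ((div_le_one (by positivity)).2 ?_), ?_⟩
    · have : (0 : ℝ) ≤ n := Nat.cast_nonneg n
      linarith
    · calc 2 * (n : ℝ) * min ε₀ (1 / (2 * n + 1)) ≤ 2 * n * (1 / (2 * n + 1)) := by
            gcongr
            exact min_le_right _ _
        _ = 2 * n / (2 * n + 1) := by ring
        _ ≤ 1 := by rw [div_le_one (by positivity)]; linarith
  refine ⟨C / ρ + C / ρ ^ 2, by positivity, ε₁ * ρ, by positivity, fun K₀ hK₀ hδ => ?_⟩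
  obtain ⟨δ, hδe⟩ : ∃ δ, δ = Metric.hausdorffDist K₀ H.body := ⟨_, rfl⟩
  rw [← hδe] at hδ ⊢
  have hδ0 : 0 ≤ δ := by rw [hδe]; exact Metric.hausdorffDist_nonneg
  obtain ⟨ε, hε⟩ : ∃ ε, ε = δ / ρ := ⟨_, rfl⟩
  have hε0 : 0 ≤ ε := by rw [hε]; positivity
  have hδε : δ = ε * ρ := by rw [hε]; field_simp
  have hεε₁ : ε ≤ ε₁ := by
    rw [hε, div_le_iff₀ hρ0]; exact hδ.le
  have hε1 := hεε₁.trans hε₁1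
  have hne : K₀.Nonempty := hK₀.nonempty_interior.mono interior_subset
  have hfin := Metric.hausdorffEDist_ne_top_of_nonempty_of_bounded hne ⟨0, H.zero_mem_body⟩
    hK₀.isCompact.isBounded H.isCompact_body.isBounded
  have hd1 : ∀ x ∈ K₀, ∃ y ∈ H.body, ‖x - y‖ ≤ δ := by
    intro x hx
    obtain ⟨y, hy, hxy⟩ := H.isCompact_body.exists_infDist_eq_dist ⟨0, H.zero_mem_body⟩ x
    refine ⟨y, hy, ?_⟩
    rw [← dist_eq_norm, ← hxy, hδe]
    exact Metric.infDist_le_hausdorffDist_of_mem hx hfin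
  have hd2 : ∀ x ∈ H.body, ∃ y ∈ K₀, ‖x - y‖ ≤ δ := by
    intro x hx
    obtain ⟨y, hy, hxy⟩ := hK₀.isCompact.exists_infDist_eq_dist hne x
    refine ⟨y, hy, ?_⟩
    rw [← dist_eq_norm, ← hxy, hδe, Metric.hausdorffDist_comm]
    exact Metric.infDist_le_hausdorffDist_of_mem hx (by rwa [Metric.hausdorffEDist_comm])
  have hδρ : δ ≤ ρ := by
    rw [hδε]
    have : ε * ρ ≤ 1 * ρ := by gcongr
    linarith
  have hballK : Metric.closedBall 0 ρ ⊆ K₀ :=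
    hK₀.convex.closedBall_subset_of_forall_dist_le hK₀.isCompact.isClosed hρ0.le hδ0
      fun x hx => hd2 x (hball (by rw [mem_closedBall_zero_iff]; linarith))
  have hKH : ∀ x ∈ K₀, (1 + ε)⁻¹ • x ∈ H.body := by
    intro x hx
    obtain ⟨y, hy, hxy⟩ := hd1 x hx
    have := H.convex_body.inv_smul_add_mem hballρ hy hε0 (hδε ▸ hxy)
    rwa [add_sub_cancel] at this
  have hHK : ∀ x ∈ H.body, (1 + ε)⁻¹ • x ∈ K₀ := by
    intro x hx
    obtain ⟨y, hy, hxy⟩ := hd2 x hx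
    have := hK₀.convex.inv_smul_add_mem hballK hy hε0 (hδε ▸ hxy)
    rwa [add_sub_cancel] at this
  -- One point `X i` and one functional `f i` are fixed for each coordinate face; together they
  -- determine `E`.
  choose X hXm f h1 h2 hX0 hX hf hfi hfL hfj using
    exists_xPoint_coord hH hK₀ hε0 hKH hHK
  have hXK := H.xPoints_subset hK₀.isCompact.isClosed
  have h1ε : 0 < 1 + ε := by linarith
  obtain ⟨S, hS⟩ : ∃ S : EucSp n →ₗ[ℝ] EucSp n,
      ∀ x, S x = x - Matrix.toEuclideanLin (correction H.Linked X f) x :=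
    ⟨LinearMap.id - Matrix.toEuclideanLin (correction H.Linked X f), fun _ => rfl⟩
  have a1 : ∀ x, ‖S x - x‖ ≤ 2 * n ^ 2 * ε * ‖x‖ := by
    intro x
    rw [hS, sub_sub_cancel_left, norm_neg]
    have := norm_toEuclideanLin_le (abs_correction_le (L := H.Linked) hε0 h1 h2 hX hfj)
      (by positivity) x
    linarith
  have a2 : ∀ x ∈ H.xPoints K₀, ∀ i, S x i ≤ 1 + n * (6 + 8 * n) * ε ^ 2 := by
    simp only [hS]
    intro x hx i
    have hxH := hKH x (hXK hx)
    refine correction_apply_le (L := H.Linked) hε0 hε1 h1 h2 hX hfj hfi hfL ?_ ?_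
      (hf i x (hXK hx))
    · intro i j hij
      have := abs_add_abs_le_one hH.1 hij hxH
      simp only [PiLp.smul_apply, smul_eq_mul, abs_mul, abs_of_pos (inv_pos.2 h1ε),
        ← mul_add] at this
      rw [inv_mul_le_iff₀ h1ε] at this
      linarith [le_abs_self (x i)]
    · intro i
      have := abs_coord_le_one hH.1 hxH i
      simp only [PiLp.smul_apply, smul_eq_mul, abs_mul, abs_of_pos (inv_pos.2 h1ε)] at this
      rw [inv_mul_le_iff₀ h1ε] at this
      linarith
  have a3 : ∀ i, ∃ p ∈ convexHull ℝ (H.xPoints K₀), ‖S p - EuclideanSpace.single i (1 : ℝ)‖ ≤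
      ((1 + 2 * n ^ 2) * (2 * n * (c + 2 * n)) + (2 * n ^ 2) ^ 2) * ε ^ 2 := by
    simp only [hS]
    intro i
    have hεn : 2 * n * ε ≤ 1 := le_trans (by gcongr) hε₁n
    exact exists_correction_near_single (fun i j h => h.symm) hε0 hε1 hεn h1 h2 hX hX0 hfj
      (convex_convexHull ℝ _) (hnear K₀ hK₀ ε hε0 hε1 hKH hHK) i (subset_convexHull ℝ _ (hXm i))
      (not_linked_self hH.1 i) fun u hu hui hul =>
        single_add_mem_body hH.1 (hH.2 i) (crossBall_subset_body hH hu) hui hul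
  obtain ⟨K, k1, k2, k3, k4, k5, k6⟩ := main (H.xPoints K₀) H.body
    S ε hε0 (hεε₁.trans hε₁)
    (H.xPoints_finite hK₀) (H.neg_xPoints hK₀.symm) H.convex_body hball hR
    (fun i => single_mem_body (hH.2 i)) (fun i => neg_mem_body (single_mem_body (hH.2 i)))
    (fun x hx => hKH x (hXK hx)) (hnear K₀ hK₀ ε hε0 hε1 hKH hHK) a1 a2 a3
  refine ⟨K, k1, k2, k3.trans ?_, k4.trans ?_, k5, k6⟩
  · have : C * ε ^ 2 = C / ρ ^ 2 * δ ^ 2 := by rw [hε]; field_simp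
    have h0 : 0 ≤ C / ρ * δ ^ 2 := by positivity
    linarith
  · have : C * ε = C / ρ * δ := by rw [hε]; field_simp
    have h0 : 0 ≤ C / ρ ^ 2 * δ := by positivity
    linarith

end HannerTree

theorem mainTheorem7 (n : ℕ) :
    ∃ C : ℝ, 0 < C ∧ ∃ δ₀ : ℝ, 0 < δ₀ ∧
      ∀ H : HannerTree n, H.IsStandard →
      ∀ K₀ : Set (EucSp n), IsSymmConvexBody K₀ →
      ∀ δ : ℝ, Metric.hausdorffDist K₀ H.body = δ → δ < δ₀ →
        ∃ K : Set (EucSp n), IsPolytope K ∧ IsSymmConvexBody K ∧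
          |bmDist K (xPointHull H K₀) - 1| ≤ C * δ ^ 2 ∧
          Metric.hausdorffDist K H.body ≤ C * δ ∧
          crossBall n ⊆ K ∧ K ⊆ cubeBall n := by
  choose! C hC d hd main using fun (H : HannerTree n) (hH : H.IsStandard) =>
    HannerTree.exists_polytope_near hH
  have hfin := HannerTree.finite_isStandard (n := n)
  obtain ⟨M, hM⟩ := (hfin.image C).bddAbove
  -- A positive lower bound for the finitely many thresholds is obtained from an upper bound for
  -- their inverses.
  obtain ⟨m, hm, hmd⟩ : ∃ m : ℝ, 0 < m ∧ ∀ H : HannerTree n, H.IsStandard → m ≤ d H := by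
    obtain ⟨N, hN⟩ := (hfin.image fun H => (d H)⁻¹).bddAbove
    refine ⟨(max N 1)⁻¹, by positivity, fun H hH => ?_⟩
    rw [inv_le_comm₀ (by positivity) (hd H hH)]
    exact (hN (Set.mem_image_of_mem (fun H => (d H)⁻¹) hH)).trans (le_max_left _ _)
  refine ⟨max M 1, by positivity, m, hm, ?_⟩
  rintro H hH K₀ hK₀ δ rfl hδ
  obtain ⟨K, h1, h2, h3, h4, h5⟩ := main H hH K₀ hK₀ (hδ.trans_le (hmd H hH))
  have hCM : C H ≤ max M 1 := (hM (Set.mem_image_of_mem C hH)).trans (le_max_left _ _)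
  have h0 : 0 ≤ Metric.hausdorffDist K₀ H.body := Metric.hausdorffDist_nonneg
  exact ⟨K, h1, h2, h3.trans (by gcongr), h4.trans (by gcongr), h5⟩
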